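/- **Setting.** Let $p\in\mathbb N$ and $[p]=\{1,\dots,p\}$. On a probability space $(\Omega,\mathcal A,\mathbb P)$ let $\boldsymbol\xi_u=(\xi_u^{i,j})_{i,j\in[p]}$, $u\in\mathcal I=\bigcup_{n\ge 0}\mathbb N^n$, be i.i.d. matrices of (arbitrarily correlated) point processes on $[0,\infty)$ (integer-valued random measures, finite on bounded intervals, possibly of infinite total mass), independent of an $[p]$-valued random variable $\tau(\varnothing)$, the type of the ancestor $\varnothing$; write $\mathbb P^i=\mathbb P(\,\cdot\mid\tau(\varnothing)=i)$ and $\mathbb E^i$ for its expectation, for each $i$ with $\mathbb P(\tau(\varnothing)=i)>0$. The ancestor is born at time $S(\varnothing)=0$. An individual $u$ of type $\tau(u)$ born at time $S(u)<\infty$ has, for each $j$, children of type $j$ born at the times $S(u)+x$, $x$ running through the points of $\xi_u^{\tau(u),j}$. Its children $u1,u2,\dots$ are numbered in the order of their birth times, simultaneous births in increasing order of the types. If $u$ is never born, $S(u)=\infty$. Let $\mathcal G=\{u:S(u)<\infty\}$ be the family tree. For $t\ge0$ let $$\mathcal C_t=\{uj\in\mathcal G: S(u)\le t<S(uj)\},\qquad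 \mathcal F_t=\sigma\big(\{A\cap\{S(u)\le t\}:u\in\mathcal I,\ A\in\mathcal A_u\}\big),$$ where $\mathcal A_u=\sigma(\tau(\varnothing),\boldsymbol\xi_v: v\text{ is }u\text{ or an ancestor of }u)$. Let $\mu^{i,j}=\mathbb E[\xi_\varnothing^{i,j}]$ be the intensity measures and $\boldsymbol\mu=(\mu^{i,j})$, let $\mathcal D=\{z\in\mathbb C:\int e^{-\mathrm{Re}(z)x}\mu^{i,j}(dx)<\infty\text{ for all }i,j\}$, and $\mathcal L\boldsymbol\mu(z)=\big(\int e^{-zx}\mu^{i,j}(dx)\big)_{i,j}$ for $z\in\mathcal D$. **Assumptions.** The matrix $(\mu^{i,j}(\{0\}))_{i,j}$ has spectral radius $<1$; there is a real $\alpha>0$ in $\mathcal D$ such that $\mathcal L\boldsymbol\mu(\alpha)$ has spectral radius $1$; and $\lambda$ is an interior point of $\mathcal D$ with $\det(I_p-\mathcal L\boldsymbol\mu(\lambda))=0$. **Notation.** Let $k$ be the maximal order of the poles at $\lambda$ of the entries of $(I_p-\mathcal L\boldsymbol\mu(z))^{-1}$, let $A_{\lambda,l}$ be the $p\times p$ matrix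 of the coefficients of $(z-\lambda)^{-l}$ in the Laurent expansions of these entries around $\lambda$, and let $\vec A_\lambda$ be the $kp\times p$ matrix with blocks $A_{\lambda,1},\dots,A_{\lambda,k}$, stacked from top to bottom. Let $\exp(\lambda,x)$ be the upper triangular $k\times k$ matrix with entries $e^{\lambda x}x^{b-a}/(b-a)!$ for $1\le a\le b\le k$, let $e_j$ be the $j$-th canonical row vector of length $p$, and let $\otimes$ be the Kronecker product. For $u\in\mathcal I$ and $t\in\mathbb R$ put $$\phi_{\lambda,u}(t)=\mathbf 1_{[0,\infty)}(t)\Big(\int\mathbf 1_{(t,\infty)}(s)\,\exp(\lambda,t-s)\otimes\boldsymbol\xi_u(ds)\Big)\vec A_\lambda ,$$ and for $t\ge0$ $$W_t(\lambda)=\exp(\lambda,-t)\,\mathcal Z_t^{\phi_\lambda},\qquad \mathcal Z_t^{\phi_\lambda}=\sum_{u\in\mathcal I,\;S(u)<\infty}(I_k\otimes e_{\tau(u)})\,\phi_{\lambda,u}(t-S(u)).$$ **Theorem.** Almost surely, for all $t\ge0$ simultaneously, the sum defining $\mathcal Z_t^{\phi_\lambda}$ has only finitely many nonzero terms. The family $(\mathcal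 F_t)_{t\ge0}$ is a filtration and $(W_t(\lambda))_{t\ge 0}$ is a martingale with respect to it. For every $i\in[p]$ with $\mathbb P(\tau(\varnothing)=i)>0$ and every $t\ge0$, $$\mathbb E^{i}[W_t(\lambda)]=\mathbb E^{i}[W_0(\lambda)]=(I_k\otimes e_{i})\,\vec A_\lambda .$$ Moreover, almost surely, for all $t\ge0$, $$W_t(\lambda)=\sum_{u\in\mathcal C_t}\big(\exp(\lambda,-S(u))\otimes e_{\tau(u)}\big)\vec A_\lambda ,$$ the series being unconditionally convergent. -/

import Mathlib

open MeasureTheory ProbabilityTheory Filter Topology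
open scoped NNReal ENNReal Kronecker

noncomputable section

namespace CMJ

/-! ### Point measures on the half-line -/

/-- A (deterministic) point configuration on `[0, ∞)`: a measure with values in `ℕ ∪ {∞}` that is
finite on bounded intervals. -/
def IsPointMeasure (ν : Measure ℝ≥0) : Prop :=
  (∀ B : Set ℝ≥0, MeasurableSet B → ∃ n : ℕ∞, ν B = (n : ℝ≥0∞)) ∧ ∀ t : ℝ≥0, ν (Set.Iic t) < ⊤

/-- Position of the `(k+1)`-st point of `ν` in increasing order,
`inf {t ≥ 0 : ν [0, t] ≥ k + 1}`, which is `∞` if `ν` has at most `k` points. -/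
def pointTime (ν : Measure ℝ≥0) (k : ℕ) : ℝ≥0∞ :=
  ⨅ (t : ℝ≥0) (_ : (k : ℝ≥0∞) + 1 ≤ ν (Set.Iic t)), (t : ℝ≥0∞)

open Classical in
/-- Let `ν j` be the configuration of the births of type-`j` children of an individual. The children
are numbered in the order of their birth times, those born at the same time being numbered in
increasing order of their types. If the child with index `k` is born at the (finite) time `x`, then
its type is the least `j` such that at least `k + 1` children are born either strictly before `x`, or
at `x` and with a type `≤ j`. (The value `i` is a placeholder for children that are not born.) -/
def childType {p : ℕ} (i : Fin p) (ν : Fin p → Measure ℝ≥0) (k : ℕ) : Fin p :=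
  let x : ℝ≥0 := (pointTime (∑ j, ν j) k).toNNReal
  let c : Finset (Fin p) := Finset.univ.filter fun j =>
    (k : ℝ≥0∞) + 1 ≤ (∑ l, ν l) (Set.Iio x) + ∑ l ∈ Finset.Iic j, ν l {x}
  if h : c.Nonempty then c.min' h else i

/-! ### The multi-type general branching process -/

variable {Ω : Type*} [MeasurableSpace Ω]

/-- The ingredients of a multi-type general (Crump-Mode-Jagers) branching process with types
`Fin p` on the probability space `(Ω, P)`.

Individuals are labelled by finite sequences of natural numbers, written with the most recent index
first: `[]` is the ancestor and `k :: u` is the `(k+1)`-st child of `u`. Thus `v` is an ancestor of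
`u` (or `u` itself) iff `v` is a suffix of `u`, that is, `v <:+ u`. -/
structure Branching (p : ℕ) (P : Measure Ω) where
  /-- The type of the ancestor. -/
  rootType : Ω → Fin p
  /-- The offspring process matrices: `ξ u ω i j` is the configuration of the ages at which the
  individual `u` produces children of type `j`, provided that `u` is of type `i`. -/
  ξ : List ℕ → Ω → Fin p → Fin p → Measure ℝ≥0
  measurable_rootType : Measurable rootType
  measurable_ξ : ∀ u, Measurable (ξ u)
  isPointMeasure : ∀ u ω i j, IsPointMeasure (ξ u ω i j)
  /-- The offspring process matrices are independent … -/
  indep : iIndepFun ξ P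
  /-- … and identically distributed, … -/
  identDistrib : ∀ u, IdentDistrib (ξ u) (ξ []) P P
  /-- … and, jointly, independent of the type of the ancestor. -/
  indep_rootType : IndepFun rootType (fun ω u => ξ u ω) P

namespace Branching

variable {p : ℕ} {P : Measure Ω} (B : Branching p P)

/-- The type `τ(u)` of the individual `u`. -/
def type : List ℕ → Ω → Fin p
  | [], ω => B.rootType ω
  | k :: u, ω => childType (type u ω) (B.ξ u ω (type u ω)) k

/-- `X_{u,k}`: the age of `u` at the birth of its child `k :: u`; `∞` if there is no such child. -/
def X (u : List ℕ) (k : ℕ) (ω : Ω) : ℝ≥0∞ :=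
  pointTime (∑ j, B.ξ u ω (B.type u ω) j) k

/-- The birth time `S(u)`; it is `∞` if `u` is never born. -/
def S : List ℕ → Ω → ℝ≥0∞
  | [], _ => 0
  | k :: u, ω => S u ω + B.X u k ω

/-- `u` belongs to the family tree. -/
def IsBorn : List ℕ → Ω → Prop
  | [], _ => True
  | k :: u, ω => IsBorn u ω ∧ B.X u k ω < ⊤

/-- The coming generation at time `t`: the individuals of the family tree that are born strictly
after time `t` and whose parents are born at or before time `t`. -/
def coming (t : ℝ≥0) (ω : Ω) : Set (List ℕ) :=
  {w | ∃ (u : List ℕ) (k : ℕ), w = k :: u ∧ B.IsBorn (k :: u) ω ∧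
    B.S u ω ≤ (t : ℝ≥0∞) ∧ (t : ℝ≥0∞) < B.S (k :: u) ω}

/-- The information carried by the type of the ancestor and by the offspring process matrices of
`u` and of all ancestors of `u`. -/
@[reducible] def lineageSigma (u : List ℕ) : MeasurableSpace Ω :=
  MeasurableSpace.comap B.rootType inferInstance ⊔
    ⨆ (v : List ℕ) (_ : v <:+ u), MeasurableSpace.comap (B.ξ v) inferInstance

/-- The σ-algebra `F_t` generated by the events `A ∩ {S(u) ≤ t}`, where `u` is any label and `A`
belongs to `lineageSigma u`. -/
@[reducible] def sigmaF (t : ℝ≥0) : MeasurableSpace Ω :=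
  MeasurableSpace.generateFrom
    {E | ∃ (u : List ℕ) (A : Set Ω), MeasurableSet[B.lineageSigma u] A ∧
      E = A ∩ {ω | B.S u ω ≤ (t : ℝ≥0∞)}}

/-! ### Intensity measures and Laplace transforms -/

/-- The intensity measure `μ^{i,j} = E[ξ^{i,j}]`. -/
def intensity (i j : Fin p) : Measure ℝ≥0 :=
  P.bind fun ω => B.ξ [] ω i j

/-- The domain of the matrix-valued Laplace transform `Lμ`. -/
def laplaceDom : Set ℂ :=
  {z | ∀ i j : Fin p,
    ∫⁻ x : ℝ≥0, ENNReal.ofReal (Real.exp (-(z.re * (x : ℝ)))) ∂(B.intensity i j) < ⊤}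

/-- The matrix-valued Laplace transform `Lμ(z) = (∫ e^{-zx} μ^{i,j}(dx))_{i,j}`, to be used for
`z ∈ laplaceDom`. -/
def laplace (z : ℂ) : Matrix (Fin p) (Fin p) ℂ :=
  Matrix.of fun i j => ∫ x : ℝ≥0, Complex.exp (-(z * ((x : ℝ) : ℂ))) ∂(B.intensity i j)

/-- The spectral radius of the matrix `μ({0})` of expected numbers of offspring born
immediately is less than `1`. (Its entries are finite as soon as `laplaceDom` is nonempty.) -/
def InstantSubcritical : Prop :=
  spectralRadius ℂ
    (Matrix.of fun i j : Fin p => (((B.intensity i j {0}).toReal : ℝ) : ℂ)) < 1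

/-- There is a Malthusian parameter `α > 0`. -/
def HasMalthusian : Prop :=
  ∃ α : ℝ, 0 < α ∧ (α : ℂ) ∈ B.laplaceDom ∧ spectralRadius ℂ (B.laplace (α : ℂ)) = 1

/-! ### Laurent coefficients of the resolvent -/

/-- The resolvent `(I - Lμ(z))⁻¹`. -/
def resolvent (z : ℂ) : Matrix (Fin p) (Fin p) ℂ :=
  (1 - B.laplace z)⁻¹

end Branching

/-- The coefficient of `(z - c)^{-(n+1)}` in the Laurent expansion around `c` of a function `f` that
is holomorphic in a punctured neighbourhood of `c`: it is `(2πi)⁻¹ ∮_{|z-c|=r} (z-c)^n f(z) dz`,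
which does not depend on `r` for small `r > 0`. -/
def laurentCoeff (f : ℂ → ℂ) (c : ℂ) (n : ℕ) : ℂ :=
  limUnder (𝓝[>] (0 : ℝ)) fun r : ℝ =>
    (2 * (Real.pi : ℂ) * Complex.I)⁻¹ * ∮ z in C(c, r), (z - c) ^ n * f z

/-- The order of the pole of a meromorphic function `f` at `c`; `0` if there is no pole. -/
def poleOrder (f : ℂ → ℂ) (c : ℂ) : ℕ :=
  (-(meromorphicOrderAt f c).untop₀).toNat

/-- The `k × k` matrix `exp(λ, x)`, with entries `e^{λx} x^{b-a} / (b-a)!` for `a ≤ b`, and `0`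
below the diagonal. -/
def expMat (k : ℕ) (lam : ℂ) (x : ℝ) : Matrix (Fin k) (Fin k) ℂ :=
  Matrix.of fun a b =>
    if a ≤ b then
      Complex.exp (lam * (x : ℂ)) *
        ((x : ℂ) ^ ((b : ℕ) - (a : ℕ)) / (Nat.factorial ((b : ℕ) - (a : ℕ)) : ℂ))
    else 0

/-- The canonical row vector `e_j`. -/
def rowVec {p : ℕ} (j : Fin p) : Matrix Unit (Fin p) ℂ :=
  Matrix.of fun _ => Pi.single j 1

/-- The Kronecker product `M ⊗ e_j`, a `k × kp` matrix. -/
def kronRow {p k : ℕ} (M : Matrix (Fin k) (Fin k) ℂ) (j : Fin p) :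
    Matrix (Fin k) (Fin k × Fin p) ℂ :=
  (M ⊗ₖ rowVec j).submatrix (fun a => (a, ())) id

/-- The `kp × kp` matrix `∫ f(s) ⊗ ν(ds)` for a `k × k` matrix-valued function `f` and a `p × p`
matrix of measures `ν`. -/
def kronIntegral {p k : ℕ} (f : ℝ≥0 → Matrix (Fin k) (Fin k) ℂ)
    (ν : Fin p → Fin p → Measure ℝ≥0) : Matrix (Fin k × Fin p) (Fin k × Fin p) ℂ :=
  Matrix.of fun x y => ∫ s, f s x.1 y.1 ∂(ν x.2 y.2)

namespace Branching

variable {p : ℕ} {P : Measure Ω} (B : Branching p P)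

/-- `k_λ`, the maximal order of the poles of the entries of the resolvent at `λ`. -/
def kOrd (lam : ℂ) : ℕ :=
  Finset.univ.sup fun ij : Fin p × Fin p =>
    poleOrder (fun z => B.resolvent z ij.1 ij.2) lam

/-- The `k_λ p × p` matrix `A_λ = ∑_l f_lᵀ ⊗ A_{λ,l}`, whose blocks, from top to bottom, are
`A_{λ,1}, …, A_{λ,k_λ}`, where `A_{λ,l}` is the matrix of the coefficients of `(z - λ)^{-l}` of the
entries of the resolvent. -/
def vecA (lam : ℂ) : Matrix (Fin (B.kOrd lam) × Fin p) (Fin p) ℂ :=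
  Matrix.of fun x j => laurentCoeff (fun z => B.resolvent z x.2 j) lam (x.1 : ℕ)

/-! ### The process counted with a characteristic, and the martingale -/

/-- The characteristic
`φ_{λ,u}(t) = 1_{[0,∞)}(t) (∫ 1_{(t,∞)}(s) exp(λ, t - s) ⊗ ξ_u(ds)) A_λ`. -/
def phi (lam : ℂ) (u : List ℕ) (ω : Ω) (t : ℝ) :
    Matrix (Fin (B.kOrd lam) × Fin p) (Fin p) ℂ :=
  open Classical in
  if 0 ≤ t then
    kronIntegral
      (fun s : ℝ≥0 => if t < (s : ℝ) then expMat (B.kOrd lam) lam (t - (s : ℝ)) else 0) (B.ξ u ω)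
      * B.vecA lam
  else 0

/-- The contribution `(I_k ⊗ e_{τ(u)}) φ_{λ,u}(t - S(u))` of the individual `u` to the process
counted with the characteristic `φ_λ` (it vanishes if `S(u) = ∞`). -/
def contribution (lam : ℂ) (t : ℝ≥0) (u : List ℕ) (ω : Ω) :
    Matrix (Fin (B.kOrd lam)) (Fin p) ℂ :=
  open Classical in
  if B.S u ω = ⊤ then 0
  else kronRow 1 (B.type u ω) * B.phi lam u ω ((t : ℝ) - (B.S u ω).toReal)

/-- The process `Z_t^{φ_λ}` counted with the characteristic `φ_λ`. -/
def Zphi (lam : ℂ) (t : ℝ≥0) (ω : Ω) : Matrix (Fin (B.kOrd lam)) (Fin p) ℂ :=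
  ∑' u : List ℕ, B.contribution lam t u ω

/-- `W_t(λ) = exp(λ, -t) Z_t^{φ_λ}`. -/
def W (lam : ℂ) (t : ℝ≥0) (ω : Ω) : Matrix (Fin (B.kOrd lam)) (Fin p) ℂ :=
  expMat (B.kOrd lam) lam (-(t : ℝ)) * B.Zphi lam t ω

/-- The law `P^i` of the process with an ancestor of type `i`. -/
def lawGiven (i : Fin p) : Measure Ω :=
  ProbabilityTheory.cond P (B.rootType ⁻¹' {i})

end Branching

end CMJ

end

/-!
# The martingales of a multi-type general branching process

For a born individual `u` put `ψ_u = (exp(λ, -S(u)) ⊗ e_{τ(u)}) A_λ`. The proof has a pathwise part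
and a part about expectations.

*Pathwise.* The children of `u` of type `j` are born at the points of `ξ_u^{τ(u),j}`, shifted by
`S(u)`: the numbering of the children distributes the points of the superposition over the types in
such a way that every `ξ_u^{τ(u),j}` is the sum of the Dirac masses at the children of type `j`
(`eq_sum_dirac_pointTime`). As `exp(λ, x + y) = exp(λ, x) exp(λ, y)`, the contribution of `u` to
`W_t` is the sum of `ψ_v` over the children `v` of `u` that are born after `t`. Therefore
`W_t = ∑_{v ∈ C_t} ψ_v` (`Branching.hasSum_coming`). Moreover `C_t` arises from the ancestor by
replacing every individual born by time `t` by its children, so that `W_t` is `ψ_∅` plus the sum of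
the increments `∑_{v child of u} ψ_v - ψ_u` over all `u` with `S(u) ≤ t`
(`Branching.W_eq_psi_add_sum_increment`).

*Expectations.* Up to the factor `exp(λ, -S(u)) ⊗ e_{τ(u)}`, which is independent of `ξ_u`, the
increment of `u` is `(∫ exp(λ, -s) ⊗ ξ_u(ds) - I) A_λ`, whose mean is zero because of the eigenvector
equation `(∫ exp(λ, -s) ⊗ μ(ds)) A_λ = A_λ` (`Branching.kronIntegral_intensity_mul_vecA`). That
equation compares coefficients in the principal parts at `λ` of `R = I + Lμ R`, where
`R = (I - Lμ)⁻¹`. An event of `F_s`, intersected with `{s < S(u)}`, does not depend on `ξ_u`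
(`Branching.measurableSet_othersSigma_inter`), so the increments of the individuals born in `(s, t]`
have mean zero on the events of `F_s`. This is the martingale property. The same argument on the
event `{τ(∅) = i}` gives the means under `P^i`.

The exchange of the sum and the expectation rests on `∑_u P(S(u) ≤ t) < ∞`
(`Branching.tsum_measure_S_le_lt_top`), which also yields that only finitely many individuals are
born by time `t`. As `β → ∞`, `Lμ(β)` tends to `μ({0})`, whose spectral radius is less than `1`.
Therefore some power of `Lμ(β)` has norm less than `1` for
large `β`; hence `∑_u E[e^{-β S(u)}]`, which is bounded by the row sums of the Neumann series of
`Lμ(β)`, is finite. The same fact shows that `det (I - Lμ)` does not vanish identically, so that `R`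
is meromorphic at `λ`.
-/

namespace CMJ

/-! ### The points of a point measure -/

namespace IsPointMeasure

variable {ν : Measure ℝ≥0}

theorem exists_nat (h : IsPointMeasure ν) {B : Set ℝ≥0} (hB : MeasurableSet B) {t : ℝ≥0}
    (ht : B ⊆ Set.Iic t) : ∃ n : ℕ, ν B = n := by
  obtain ⟨n, hn⟩ := h.1 B hB
  have hlt : ν B < ⊤ := (measure_mono ht).trans_lt (h.2 t)
  rw [hn] at hlt
  lift n to ℕ using by rintro rfl; simp at hlt
  exact ⟨n, by simpa using hn⟩

theorem sum {ι : Type*} (s : Finset ι) {ν : ι → Measure ℝ≥0} (h : ∀ j, IsPointMeasure (ν j)) :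
    IsPointMeasure (∑ j ∈ s, ν j) := by
  refine ⟨fun B hB => ?_, fun t => ?_⟩
  · choose n hn using fun j => (h j).1 B hB
    refine ⟨∑ j ∈ s, n j, ?_⟩
    rw [Measure.finsetSum_apply]
    simp only [hn]
    exact (map_sum ENat.toENNRealRingHom n s).symm
  · rw [Measure.finsetSum_apply]
    exact ENNReal.sum_lt_top.2 fun j _ => (h j).2 t

/-- The infimum in the definition of `pointTime` is attained, because `t ↦ ν [0, t]` is
right-continuous. -/
theorem pointTime_le_iff (h : IsPointMeasure ν) (k : ℕ) (t : ℝ≥0) :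
    pointTime ν k ≤ t ↔ (k : ℝ≥0∞) + 1 ≤ ν (Set.Iic t) := by
  refine ⟨fun hk => ?_, fun hk => iInf₂_le t hk⟩
  have key : ∀ n : ℕ, (k : ℝ≥0∞) + 1 ≤ ν (Set.Iic (t + 1 / ((n : ℝ≥0) + 1))) := fun n => by
    have hlt : pointTime ν k < ((t + 1 / ((n : ℝ≥0) + 1) : ℝ≥0) : ℝ≥0∞) :=
      hk.trans_lt (ENNReal.coe_lt_coe.2 (lt_add_of_pos_right _ (by positivity)))
    simp only [pointTime, iInf_lt_iff] at hlt
    obtain ⟨s, hs, hst⟩ := hlt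
    exact hs.trans (measure_mono (Set.Iic_subset_Iic.2 (ENNReal.coe_lt_coe.1 hst).le))
  have hI : Set.Iic t = ⋂ n : ℕ, Set.Iic (t + 1 / ((n : ℝ≥0) + 1)) := by
    ext x
    simp only [Set.mem_Iic, Set.mem_iInter]
    refine ⟨fun hx n => hx.trans (le_add_of_nonneg_right (by positivity)), fun hx => ?_⟩
    have hlim : Tendsto (fun n : ℕ => t + 1 / ((n : ℝ≥0) + 1)) atTop (𝓝 (t + 0)) :=
      tendsto_const_nhds.add tendsto_one_div_add_atTop_nhds_zero_nat
    rw [add_zero] at hlim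
    exact ge_of_tendsto' hlim hx
  rw [hI, Antitone.measure_iInter]
  · exact le_iInf key
  · intro m n hmn
    refine Set.Iic_subset_Iic.2 (add_le_add le_rfl ?_)
    exact one_div_le_one_div_of_le (by positivity) (by gcongr)
  · exact fun n => measurableSet_Iic.nullMeasurableSet
  · exact ⟨0, (h.2 _).ne⟩

theorem pointTime_lt_iff (h : IsPointMeasure ν) (k : ℕ) (t : ℝ≥0) :
    pointTime ν k < t ↔ (k : ℝ≥0∞) + 1 ≤ ν (Set.Iio t) := by
  constructor
  · intro hlt
    simp only [pointTime, iInf_lt_iff] at hlt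
    obtain ⟨s, hs, hst⟩ := hlt
    exact hs.trans (measure_mono fun x hx => lt_of_le_of_lt hx (ENNReal.coe_lt_coe.1 hst))
  · intro hk
    by_contra hcon
    have ht0 : 0 < t := by
      rcases eq_zero_or_pos t with rfl | h0
      · simp at hk
      · exact h0
    obtain ⟨u, hmono, hu, hlim⟩ := exists_seq_strictMono_tendsto' ht0
    have hU : Set.Iio t = ⋃ n, Set.Iic (u n) :=
      (iUnion_Iic_eq_Iio_of_lt_of_tendsto (fun n => (hu n).2) hlim).symm
    have hle : ν (Set.Iio t) ≤ k := by
      rw [hU, Monotone.measure_iUnion fun m n hmn => Set.Iic_subset_Iic.2 (hmono.monotone hmn)]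
      refine iSup_le fun n => ?_
      obtain ⟨m, hm⟩ := h.exists_nat measurableSet_Iic (subset_refl (Set.Iic (u n)))
      have hn : ¬ ((k : ℝ≥0∞) + 1 ≤ ν (Set.Iic (u n))) := fun hc =>
        hcon (((h.pointTime_le_iff k (u n)).2 hc).trans_lt (ENNReal.coe_lt_coe.2 (hu n).2))
      rw [hm] at hn ⊢
      have : ¬ (k + 1 ≤ m) := fun hc => hn (by exact_mod_cast hc)
      exact_mod_cast (by omega : m ≤ k)
    have hc := hk.trans hle
    have : k + 1 ≤ k := by exact_mod_cast hc
    omega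

/-- The measure `ν` does not charge the complement of the countable set of its points. -/
theorem measure_compl_range_pointTime (h : IsPointMeasure ν) :
    ν (Set.range fun k => (pointTime ν k).toNNReal)ᶜ = 0 := by
  classical
  set C : Set ℝ≥0 := Set.range fun k => (pointTime ν k).toNNReal with hC
  have hCm : MeasurableSet C := (Set.countable_range _).measurableSet
  -- the sum of the Dirac masses at the points is carried by `C` and has the same distribution
  -- function as `ν`
  set σ : Measure ℝ≥0 := Measure.sum fun k : ℕ =>
    if pointTime ν k = ⊤ then 0 else Measure.dirac (pointTime ν k).toNNReal with hσ
  have hσC : σ Cᶜ = 0 := by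
    rw [hσ, Measure.sum_apply _ hCm.compl, ENNReal.tsum_eq_zero]
    intro k
    split_ifs
    · simp
    · rw [Measure.dirac_apply' _ hCm.compl]
      simp [hC]
  have hσI : ∀ t, σ (Set.Iic t) = ν (Set.Iic t) := fun t => by
    obtain ⟨n, hn⟩ := h.exists_nat measurableSet_Iic (subset_refl (Set.Iic t))
    have hterm : ∀ k : ℕ, (if pointTime ν k = ⊤ then (0 : Measure ℝ≥0)
        else Measure.dirac (pointTime ν k).toNNReal) (Set.Iic t) =
        if k ∈ Finset.range n then 1 else 0 := fun k => by
      have hiff : pointTime ν k ≤ t ↔ k ∈ Finset.range n := by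
        rw [h.pointTime_le_iff, hn, Finset.mem_range]
        exact ⟨fun hc => by exact_mod_cast hc, fun hc => by exact_mod_cast hc⟩
      by_cases htop : pointTime ν k = ⊤
      · rw [if_pos htop, if_neg]
        · simp
        · rw [← hiff, htop]; simp
      · rw [if_neg htop, Measure.dirac_apply' _ measurableSet_Iic, Set.indicator_apply]
        refine if_congr ?_ rfl rfl
        rw [← hiff, Set.mem_Iic]
        conv_rhs => rw [← ENNReal.coe_toNNReal htop, ENNReal.coe_le_coe]
    rw [hσ, Measure.sum_apply _ measurableSet_Iic, tsum_congr hterm, tsum_eq_sum (s := Finset.range n)]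
    · rw [hn, Finset.sum_ite_mem]; simp
    · intro k hk; rw [if_neg hk]
  have hres : ∀ n : ℕ, σ.restrict (Set.Iic (n : ℝ≥0)) = ν.restrict (Set.Iic (n : ℝ≥0)) := fun n => by
    have : IsFiniteMeasure (σ.restrict (Set.Iic (n : ℝ≥0))) :=
      ⟨by rw [Measure.restrict_apply_univ, hσI]; exact h.2 _⟩
    refine Measure.ext_of_Iic _ _ fun t => ?_
    rw [Measure.restrict_apply measurableSet_Iic, Measure.restrict_apply measurableSet_Iic,
      Set.Iic_inter_Iic, hσI]
  have hcov : Cᶜ ⊆ ⋃ n : ℕ, Cᶜ ∩ Set.Iic (n : ℝ≥0) := fun x hx => by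
    obtain ⟨n, hn⟩ := exists_nat_ge x
    exact Set.mem_iUnion.2 ⟨n, hx, hn⟩
  refine measure_mono_null hcov (measure_iUnion_null fun n => ?_)
  rw [← Measure.restrict_apply hCm.compl, ← hres, Measure.restrict_apply hCm.compl]
  exact measure_mono_null Set.inter_subset_left hσC

end IsPointMeasure

/-! ### Children of a given type -/

section Children

variable {p : ℕ} {ν : Fin p → Measure ℝ≥0}

/-- At a point `x`, the indices of the children of type `j` born at `x` form an interval whose
length is the mass `ν j {x}`. -/
theorem exists_childType_interval (h : ∀ j, IsPointMeasure (ν j)) (i : Fin p) (x : ℝ≥0) (j : Fin p) :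
    ∃ m n : ℕ, ν j {x} = n ∧ ∀ k : ℕ,
      (pointTime (∑ l, ν l) k = x ∧ childType i ν k = j) ↔ k ∈ Finset.Ico m (m + n) := by
  classical
  have hN := IsPointMeasure.sum Finset.univ h
  obtain ⟨a, ha⟩ := hN.exists_nat measurableSet_Iio (Set.Iio_subset_Iic_self (a := x))
  choose b hb using fun l => (h l).exists_nat (measurableSet_singleton x)
    (Set.singleton_subset_iff.2 (Set.mem_Iic.2 (le_refl x)))
  have hIic : (∑ l, ν l) (Set.Iic x) = ((a + ∑ l, b l : ℕ) : ℝ≥0∞) := by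
    rw [← Set.Iio_union_right, measure_union (by simp) (measurableSet_singleton x), ha,
      Measure.finsetSum_apply]
    simp [hb]
  have hpt : ∀ k : ℕ, pointTime (∑ l, ν l) k = x ↔ a ≤ k ∧ k < a + ∑ l, b l := fun k => by
    rw [le_antisymm_iff, ← not_lt (b := (x : ℝ≥0∞)), hN.pointTime_le_iff, hN.pointTime_lt_iff,
      hIic, ha]
    have h1 : (k : ℝ≥0∞) + 1 ≤ ((a + ∑ l, b l : ℕ) : ℝ≥0∞) ↔ k + 1 ≤ a + ∑ l, b l := by
      exact_mod_cast Iff.rfl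
    have h2 : (k : ℝ≥0∞) + 1 ≤ (a : ℝ≥0∞) ↔ k + 1 ≤ a := by exact_mod_cast Iff.rfl
    rw [h1, h2]
    omega
  refine ⟨a + ∑ l ∈ Finset.Iio j, b l, b j, hb j, fun k => ?_⟩
  have hjsplit : ∑ l ∈ Finset.Iic j, b l = ∑ l ∈ Finset.Iio j, b l + b j := by
    rw [← Finset.Iio_insert, Finset.sum_insert (by simp), add_comm]
  have hjle : ∑ l ∈ Finset.Iic j, b l ≤ ∑ l, b l :=
    Finset.sum_le_sum_of_subset (Finset.subset_univ _)
  rw [Finset.mem_Ico, hpt]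
  have hc : ∀ hx : pointTime (∑ l, ν l) k = x, ∀ q : Fin p, ((k : ℝ≥0∞) + 1 ≤
      (∑ l, ν l) (Set.Iio (pointTime (∑ j, ν j) k).toNNReal) +
      ∑ l ∈ Finset.Iic q, ν l {(pointTime (∑ j, ν j) k).toNNReal}) ↔
      k + 1 ≤ a + ∑ l ∈ Finset.Iic q, b l := fun hx q => by
    rw [hx, ENNReal.toNNReal_coe, ha]
    simp only [hb]
    exact_mod_cast Iff.rfl
  constructor
  · rintro ⟨hk, hj⟩
    have hc := hc ((hpt k).2 hk)
    rw [childType] at hj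
    simp only [hc] at hj
    split_ifs at hj with hne
    · have hmem := Finset.min'_mem _ hne
      rw [hj, Finset.mem_filter] at hmem
      refine ⟨?_, by omega⟩
      by_contra hlt
      have hpos : 0 < ∑ l ∈ Finset.Iio j, b l := by omega
      obtain ⟨l0, hl0, -⟩ := Finset.exists_ne_zero_of_sum_ne_zero hpos.ne'
      -- the largest type below `j` already accounts for `k + 1` children
      set q := (Finset.Iio j).max' ⟨l0, hl0⟩ with hq
      have hqj : q < j := Finset.mem_Iio.1 (Finset.max'_mem _ _)
      have hsub : Finset.Iio j ⊆ Finset.Iic q := fun l hl =>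
        Finset.mem_Iic.2 (Finset.le_max' _ _ hl)
      have hsum : ∑ l ∈ Finset.Iio j, b l ≤ ∑ l ∈ Finset.Iic q, b l :=
        Finset.sum_le_sum_of_subset hsub
      have : j ≤ q := by
        rw [← hj]
        exact Finset.min'_le _ _ (by rw [Finset.mem_filter]; exact ⟨Finset.mem_univ _, by omega⟩)
      exact absurd hqj (not_lt.2 this)
    · exfalso
      apply hne
      have : Nonempty (Fin p) := ⟨j⟩
      set q := (Finset.univ : Finset (Fin p)).max' Finset.univ_nonempty
      refine ⟨q, Finset.mem_filter.2 ⟨Finset.mem_univ _, ?_⟩⟩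
      have : Finset.Iic q = Finset.univ :=
        Finset.eq_univ_of_forall fun l => Finset.mem_Iic.2 (Finset.le_max' _ _ (Finset.mem_univ l))
      rw [this]
      omega
  · rintro ⟨h1, h2⟩
    have hk : a ≤ k ∧ k < a + ∑ l, b l := ⟨by omega, by omega⟩
    refine ⟨hk, ?_⟩
    have hc := hc ((hpt k).2 hk)
    rw [childType]
    simp only [hc]
    have hjm : j ∈ Finset.univ.filter fun q : Fin p => k + 1 ≤ a + ∑ l ∈ Finset.Iic q, b l :=
      Finset.mem_filter.2 ⟨Finset.mem_univ _, by omega⟩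
    rw [dif_pos ⟨j, hjm⟩]
    refine le_antisymm (Finset.min'_le _ _ hjm) ?_
    refine Finset.le_min' _ _ _ fun q hq => ?_
    by_contra hlt
    have hsub : Finset.Iic q ⊆ Finset.Iio j := fun l hl =>
      Finset.mem_Iio.2 ((Finset.mem_Iic.1 hl).trans_lt (not_le.1 hlt))
    have hsum : ∑ l ∈ Finset.Iic q, b l ≤ ∑ l ∈ Finset.Iio j, b l :=
      Finset.sum_le_sum_of_subset hsub
    have := (Finset.mem_filter.1 hq).2
    omega

open Classical in
/-- The configuration of the children of type `j` is the sum of the Dirac masses at the birth times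
of those children of the numbered family which receive the type `j`. -/
theorem eq_sum_dirac_pointTime (h : ∀ j, IsPointMeasure (ν j)) (i j : Fin p) :
    ν j = Measure.sum fun k : ℕ =>
      if pointTime (∑ l, ν l) k ≠ ⊤ ∧ childType i ν k = j then
        Measure.dirac (pointTime (∑ l, ν l) k).toNNReal else 0 := by
  have hN := IsPointMeasure.sum Finset.univ h
  -- both sides are carried by the countable set `C`, so it suffices to compare the atoms
  set C : Set ℝ≥0 := Set.range fun k => (pointTime (∑ l, ν l) k).toNNReal with hC
  have hCc : C.Countable := Set.countable_range _
  have hCm : MeasurableSet C := hCc.measurableSet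
  set σ : Measure ℝ≥0 := Measure.sum fun k : ℕ =>
      if pointTime (∑ l, ν l) k ≠ ⊤ ∧ childType i ν k = j then
        Measure.dirac (pointTime (∑ l, ν l) k).toNNReal else 0 with hσ
  have hσC : σ Cᶜ = 0 := by
    rw [hσ, Measure.sum_apply _ hCm.compl, ENNReal.tsum_eq_zero]
    intro k
    split_ifs
    · rw [Measure.dirac_apply' _ hCm.compl]
      simp [hC]
    · simp
  have hνC : ν j Cᶜ = 0 := by
    have h0 := hN.measure_compl_range_pointTime
    rw [Measure.finsetSum_apply, Finset.sum_eq_zero_iff] at h0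
    exact h0 j (Finset.mem_univ j)
  have hsing : ∀ x, ν j {x} = σ {x} := fun x => by
    obtain ⟨m, n, hn, hmn⟩ := exists_childType_interval h i x j
    have hterm : ∀ k : ℕ, (if pointTime (∑ l, ν l) k ≠ ⊤ ∧ childType i ν k = j then
        Measure.dirac (pointTime (∑ l, ν l) k).toNNReal else (0 : Measure ℝ≥0)) {x} =
        if k ∈ Finset.Ico m (m + n) then 1 else 0 := fun k => by
      by_cases hk : pointTime (∑ l, ν l) k ≠ ⊤ ∧ childType i ν k = j
      · rw [if_pos hk, Measure.dirac_apply' _ (measurableSet_singleton x), Set.indicator_apply]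
        refine if_congr ?_ rfl rfl
        rw [← hmn, and_iff_left hk.2, Set.mem_singleton_iff, ← ENNReal.coe_inj,
          ENNReal.coe_toNNReal hk.1]
      · rw [if_neg hk, if_neg]
        · simp
        · rw [← hmn]
          rintro ⟨h1, h2⟩
          exact hk ⟨by rw [h1]; exact ENNReal.coe_ne_top, h2⟩
    rw [hn, hσ, Measure.sum_apply _ (measurableSet_singleton x), tsum_congr hterm,
      tsum_eq_sum (s := Finset.Ico m (m + n))]
    · rw [Finset.sum_ite_mem]; simp
    · intro k hk; rw [if_neg hk]
  have hatom : ∀ (μ : Measure ℝ≥0), μ Cᶜ = 0 → ∀ s, MeasurableSet s →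
      μ s = ∑' x : (s ∩ C : Set ℝ≥0), μ {(x : ℝ≥0)} := fun μ hμ s hs => by
    have h1 : μ s = μ (s ∩ C) := by
      rw [← measure_inter_add_sdiff s hCm, measure_mono_null (Set.sdiff_subset_compl s C) hμ, add_zero]
    rw [h1]
    conv_lhs => rw [← Set.biUnion_of_singleton (s ∩ C)]
    exact measure_biUnion (hCc.mono Set.inter_subset_right)
      (fun x _ y _ hxy => Set.disjoint_singleton.2 hxy) fun x _ => measurableSet_singleton x
  ext s hs
  rw [hatom _ hνC s hs, hatom _ hσC s hs]
  exact tsum_congr fun x => hsing x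

open Classical in
theorem tsum_children_eq_lintegral (h : ∀ j, IsPointMeasure (ν j)) (i : Fin p)
    {f : Fin p → ℝ≥0 → ℝ≥0∞} (hf : ∀ j, Measurable (f j)) :
    ∑' k : ℕ, (if pointTime (∑ l, ν l) k = ⊤ then 0
      else f (childType i ν k) (pointTime (∑ l, ν l) k).toNNReal) = ∑ j, ∫⁻ s, f j s ∂(ν j) := by
  have hj : ∀ j, ∫⁻ s, f j s ∂(ν j) = ∑' k : ℕ,
      if pointTime (∑ l, ν l) k ≠ ⊤ ∧ childType i ν k = j then
        f j (pointTime (∑ l, ν l) k).toNNReal else 0 := fun j => by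
    conv_lhs => rw [eq_sum_dirac_pointTime h i j]
    rw [lintegral_sum_measure]
    refine tsum_congr fun k => ?_
    split_ifs
    · rw [lintegral_dirac' _ (hf j)]
    · simp
  simp only [hj]
  rw [← Summable.tsum_finsetSum fun _ _ => ENNReal.summable]
  refine tsum_congr fun k => ?_
  split_ifs with hk
  · simp [hk]
  · simp [hk]

open Classical in
theorem hasSum_children_integral {E : Type*} [NormedAddCommGroup E] [NormedSpace ℝ E]
    [CompleteSpace E] (h : ∀ j, IsPointMeasure (ν j)) (i : Fin p)
    {f : Fin p → ℝ≥0 → E} (hf : ∀ j, Integrable (f j) (ν j)) :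
    HasSum (fun k : ℕ => if pointTime (∑ l, ν l) k = ⊤ then 0
      else f (childType i ν k) (pointTime (∑ l, ν l) k).toNNReal) (∑ j, ∫ s, f j s ∂(ν j)) := by
  have hj : ∀ j, HasSum (fun k : ℕ =>
      if pointTime (∑ l, ν l) k ≠ ⊤ ∧ childType i ν k = j then
        f j (pointTime (∑ l, ν l) k).toNNReal else 0) (∫ s, f j s ∂(ν j)) := fun j => by
    have hi := hf j
    conv at hi => rw [eq_sum_dirac_pointTime h i j]
    have := hasSum_integral_measure hi
    rw [← eq_sum_dirac_pointTime h i j] at this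
    convert this using 2 with k
    split_ifs <;> simp
  convert hasSum_sum (s := Finset.univ) fun j _ => hj j using 2 with k
  split_ifs with hk
  · simp [hk]
  · simp [hk]

end Children

/-! ### Measurability -/

section Kernels

variable {α β : Type*} {mα : MeasurableSpace α} {mβ : MeasurableSpace β}

/-- A kernel all of whose measures are finite is s-finite: decompose it according to the integer
part of the total mass. -/
theorem isSFiniteKernel_of_measure_univ_lt_top (κ : Kernel α β) (h : ∀ a, κ a Set.univ < ⊤) :
    IsSFiniteKernel κ := by
  classical
  have hmeas : ∀ n : ℕ, MeasurableSet {a | ⌊(κ a Set.univ).toReal⌋₊ = n} := fun n =>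
    ((Nat.measurable_floor.comp (κ.measurable_coe MeasurableSet.univ).ennreal_toReal)
      (measurableSet_singleton n))
  refine ⟨fun n => Kernel.piecewise (hmeas n) κ 0, fun n => ⟨(n : ℝ≥0∞) + 1, ?_, fun a => ?_⟩, ?_⟩
  · exact ENNReal.add_lt_top.2 ⟨ENNReal.natCast_lt_top n, ENNReal.one_lt_top⟩
  · rw [Kernel.piecewise_apply]
    split_ifs with ha
    · have h1 := (Nat.lt_floor_add_one (κ a Set.univ).toReal).le
      rw [show ⌊(κ a Set.univ).toReal⌋₊ = n from ha] at h1
      rw [← ENNReal.ofReal_toReal (h a).ne]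
      refine (ENNReal.ofReal_le_ofReal h1).trans (le_of_eq ?_)
      rw [ENNReal.ofReal_add (by positivity) zero_le_one]
      simp
    · simp
  · ext a s hs
    rw [Kernel.sum_apply' _ _ hs, tsum_eq_single ⌊(κ a Set.univ).toReal⌋₊]
    · rw [Kernel.piecewise_apply, if_pos (by simp)]
    · intro n hn
      rw [Kernel.piecewise_apply, if_neg (by simpa using hn.symm)]
      simp

/-- Joint measurability is available for s-finite kernels only; point measures form such kernels,
as they are finite on the intervals `[n, n + 1)`. -/
theorem isSFiniteKernel_of_isPointMeasure (κ : Kernel α ℝ≥0) (h : ∀ a, IsPointMeasure (κ a)) :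
    IsSFiniteKernel κ := by
  have hs : ∀ n : ℕ, MeasurableSet {x : ℝ≥0 | ⌊x⌋₊ = n} := fun n =>
    Nat.measurable_floor (measurableSet_singleton n)
  have hκ : κ = Kernel.sum fun n : ℕ => κ.restrict (hs n) := by
    ext a B hB
    rw [Kernel.sum_apply' _ _ hB]
    simp only [Kernel.restrict_apply, Measure.restrict_apply hB]
    rw [← measure_iUnion]
    · congr 1
      ext x
      simp
    · intro m n hmn
      refine Set.disjoint_left.2 fun x hx hy => hmn ?_
      exact hx.2.symm.trans hy.2
    · exact fun n => hB.inter (hs n)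
  rw [hκ]
  have : ∀ n : ℕ, IsSFiniteKernel (κ.restrict (hs n)) := fun n => by
    refine isSFiniteKernel_of_measure_univ_lt_top _ fun a => ?_
    rw [Kernel.restrict_apply, Measure.restrict_apply_univ]
    refine (measure_mono fun x hx => ?_).trans_lt ((h a).2 ((n : ℝ≥0) + 1))
    have := (Nat.lt_floor_add_one x).le
    rwa [show ⌊x⌋₊ = n from hx] at this
  exact Kernel.isSFiniteKernel_sum

variable {ν : α → Measure ℝ≥0}

theorem measurable_measure_Iio (hν : Measurable ν) (h : ∀ a, IsPointMeasure (ν a))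
    {x : α → ℝ≥0} (hx : Measurable x) : Measurable fun a => ν a (Set.Iio (x a)) := by
  let κ : Kernel α ℝ≥0 := ⟨ν, hν⟩
  have : IsSFiniteKernel κ := isSFiniteKernel_of_isPointMeasure κ h
  exact Kernel.measurable_kernel_prodMk_left (κ := κ)
    (measurableSet_lt measurable_snd (hx.comp measurable_fst))

theorem measurable_measure_singleton (hν : Measurable ν) (h : ∀ a, IsPointMeasure (ν a))
    {x : α → ℝ≥0} (hx : Measurable x) : Measurable fun a => ν a {x a} := by
  let κ : Kernel α ℝ≥0 := ⟨ν, hν⟩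
  have : IsSFiniteKernel κ := isSFiniteKernel_of_isPointMeasure κ h
  exact Kernel.measurable_kernel_prodMk_left (κ := κ)
    (measurableSet_eq_fun measurable_snd (hx.comp measurable_fst))

theorem measurable_integral_of_isPointMeasure (hν : Measurable ν) (h : ∀ a, IsPointMeasure (ν a))
    {f : α → ℝ≥0 → ℂ} (hf : Measurable (Function.uncurry f)) :
    Measurable fun a => ∫ s, f a s ∂(ν a) := by
  let κ : Kernel α ℝ≥0 := ⟨ν, hν⟩
  have : IsSFiniteKernel κ := isSFiniteKernel_of_isPointMeasure κ h
  exact (StronglyMeasurable.integral_kernel_prod_right (κ := κ) hf.stronglyMeasurable).measurable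

theorem measurable_pointTime (hν : Measurable ν) (h : ∀ a, IsPointMeasure (ν a)) (k : ℕ) :
    Measurable fun a => pointTime (ν a) k := by
  refine measurable_of_Iic fun x => ?_
  induction x with
  | top => simp
  | coe t =>
    have : (fun a => pointTime (ν a) k) ⁻¹' Set.Iic (t : ℝ≥0∞) =
        {a | (k : ℝ≥0∞) + 1 ≤ ν a (Set.Iic t)} := by
      ext a
      exact (h a).pointTime_le_iff k t
    rw [this]
    exact measurableSet_le measurable_const ((Measure.measurable_coe measurableSet_Iic).comp hν)

theorem measurable_finsetSum_measure {p : ℕ} {ν : α → Fin p → Measure β} (hν : Measurable ν) :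
    Measurable fun a => ∑ l, ν a l := by
  refine Measure.measurable_of_measurable_coe _ fun s hs => ?_
  simp only [Measure.finsetSum_apply]
  exact Finset.measurable_sum _ fun l _ =>
    (Measure.measurable_coe hs).comp (measurable_pi_iff.1 hν l)

open Classical in
/-- The least type with the property `c`, or `i` if there is none. -/
noncomputable def leastOr {p : ℕ} (i : Fin p) (c : Fin p → Prop) : Fin p :=
  if h : (Finset.univ.filter c).Nonempty then (Finset.univ.filter c).min' h else i

theorem childType_eq_leastOr {p : ℕ} (i : Fin p) (ν : Fin p → Measure ℝ≥0) (k : ℕ) :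
    childType i ν k = leastOr i fun j => (k : ℝ≥0∞) + 1 ≤
      (∑ l, ν l) (Set.Iio (pointTime (∑ l, ν l) k).toNNReal) +
        ∑ l ∈ Finset.Iic j, ν l {(pointTime (∑ l, ν l) k).toNNReal} := by
  unfold childType leastOr
  dsimp only
  congr!

theorem measurable_childType {p : ℕ} {ν : α → Fin p → Measure ℝ≥0} (hν : Measurable ν)
    (h : ∀ a l, IsPointMeasure (ν a l)) (i : Fin p) (k : ℕ) :
    Measurable fun a => childType i (ν a) k := by
  classical
  have hνl := measurable_pi_iff.1 hν
  have hsum := measurable_finsetSum_measure hν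
  have hpt : ∀ a, IsPointMeasure (∑ l, ν a l) := fun a => IsPointMeasure.sum _ (h a)
  set x : α → ℝ≥0 := fun a => (pointTime (∑ l, ν a l) k).toNNReal with hx
  have hxm : Measurable x := (measurable_pointTime hsum hpt k).ennreal_toNNReal
  have hc : ∀ j : Fin p, MeasurableSet {a | (k : ℝ≥0∞) + 1 ≤
      (∑ l, ν a l) (Set.Iio (x a)) + ∑ l ∈ Finset.Iic j, ν a l {x a}} := fun j => by
    refine measurableSet_le measurable_const ((measurable_measure_Iio hsum hpt hxm).add ?_)
    exact Finset.measurable_sum _ fun l _ =>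
      measurable_measure_singleton (hνl l) (fun a => h a l) hxm
  -- the type depends on `a` only through the finite set of the types that satisfy `hc`
  let c : α → Fin p → Prop := fun a j => (k : ℝ≥0∞) + 1 ≤
      (∑ l, ν a l) (Set.Iio (x a)) + ∑ l ∈ Finset.Iic j, ν a l {x a}
  have hcm : Measurable c := measurable_pi_iff.2 fun j => measurableSet_setOfPred.1 (hc j)
  let g : (Fin p → Prop) → Fin p := leastOr i
  have hg : Measurable g := measurable_of_countable g
  have heq : (fun a => childType i (ν a) k) = g ∘ c := funext fun a => childType_eq_leastOr i (ν a) k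
  rw [heq]
  exact hg.comp hcm

theorem measurable_apply_of_countable {ι : Type*} {mι : MeasurableSpace ι} [Countable ι] [MeasurableSingletonClass ι]
    {f : ι → α → β} (hf : ∀ i, Measurable (f i)) {τ : α → ι} (hτ : Measurable τ) :
    Measurable fun a => f (τ a) a := by
  have h := measurable_from_prod_countable_left (f := fun q : α × ι => f q.2 q.1) hf
  exact h.comp (measurable_id.prodMk hτ)

theorem measurable_childType_pointTime {p : ℕ} {ξ : α → Fin p → Fin p → Measure ℝ≥0} (hξ : Measurable ξ)
    (h : ∀ a i j, IsPointMeasure (ξ a i j)) {τ : α → Fin p} (hτ : Measurable τ) (k : ℕ) :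
    (Measurable fun a => childType (τ a) (ξ a (τ a)) k) ∧
      Measurable fun a => pointTime (∑ l, ξ a (τ a) l) k := by
  have hi : ∀ i, Measurable fun a => ξ a i := fun i => measurable_pi_iff.1 hξ i
  exact ⟨measurable_apply_of_countable (f := fun i a => childType i (ξ a i) k)
      (fun i => measurable_childType (hi i) (fun a l => h a i l) i k) hτ,
    measurable_apply_of_countable (f := fun i a => pointTime (∑ l, ξ a i l) k)
      (fun i => measurable_pointTime (measurable_finsetSum_measure (hi i))
        (fun a => IsPointMeasure.sum _ (h a i)) k) hτ⟩

end Kernels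

namespace Branching

variable {Ω : Type*} [mΩ : MeasurableSpace Ω] {p : ℕ} {P : Measure Ω} (B : Branching p P)

/-- The type and the birth time of `u` are determined by the type of the ancestor of the tree and by
the offspring processes of the strict ancestors of `u`. The σ-algebra `m` is arbitrary, in order to
cover the ambient one, `lineageSigma u` and `othersSigma u` at once. -/
theorem measurable_type_S {Ω : Type*} (m : MeasurableSpace Ω) [mΩ : MeasurableSpace Ω] {p : ℕ}
    {P : Measure Ω} (B : Branching p P) (hroot : Measurable[m] B.rootType) (u : List ℕ)
    (hξ : ∀ v, v <:+ u → v ≠ u → Measurable[m] (B.ξ v)) :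
    Measurable[m] (B.type u) ∧ Measurable[m] (B.S u) := by
  induction u with
  | nil => exact ⟨hroot, measurable_const⟩
  | cons k u ih =>
    have hu : Measurable[m] (B.ξ u) := hξ u (List.suffix_cons k u) (by simp)
    obtain ⟨ih1, ih2⟩ := ih fun v hv _ => hξ v (hv.trans (List.suffix_cons k u)) (by
      rintro rfl
      have := hv.length_le
      simp at this)
    have h := measurable_childType_pointTime hu (B.isPointMeasure u) ih1 k
    exact ⟨h.1, ih2.add h.2⟩

theorem measurable_type (u : List ℕ) : Measurable (B.type u) :=
  (B.measurable_type_S mΩ B.measurable_rootType u fun v _ _ => B.measurable_ξ v).1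

theorem measurable_S (u : List ℕ) : Measurable (B.S u) :=
  (B.measurable_type_S mΩ B.measurable_rootType u fun v _ _ => B.measurable_ξ v).2

theorem S_mono {u v : List ℕ} (h : u <:+ v) (ω : Ω) : B.S u ω ≤ B.S v ω := by
  induction v with
  | nil => rw [List.suffix_nil.1 h]
  | cons k v ih =>
    rcases List.suffix_cons_iff.1 h with rfl | h
    · exact le_rfl
    · exact (ih h).trans (by rw [S]; exact le_self_add)

theorem isBorn_iff (u : List ℕ) (ω : Ω) : B.IsBorn u ω ↔ B.S u ω ≠ ⊤ := by
  induction u with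
  | nil => simp [IsBorn, S]
  | cons k u ih => rw [IsBorn, S, ih, ENNReal.add_ne_top, lt_top_iff_ne_top]

theorem measurable_rootType_lineageSigma (u : List ℕ) :
    Measurable[B.lineageSigma u] B.rootType :=
  (comap_measurable B.rootType).mono le_sup_left le_rfl

theorem measurable_ξ_lineageSigma {u v : List ℕ} (h : v <:+ u) :
    Measurable[B.lineageSigma u] (B.ξ v) :=
  (comap_measurable (B.ξ v)).mono
    ((le_iSup₂ (f := fun (v : List ℕ) (_ : v <:+ u) =>
      MeasurableSpace.comap (B.ξ v) inferInstance) v h).trans le_sup_right) le_rfl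

theorem lineageSigma_le_of_measurable {Ω : Type*} (m : MeasurableSpace Ω) [mΩ : MeasurableSpace Ω]
    {p : ℕ} {P : Measure Ω} (B : Branching p P) (hroot : Measurable[m] B.rootType)
    (u : List ℕ) (hξ : ∀ v, v <:+ u → Measurable[m] (B.ξ v)) : B.lineageSigma u ≤ m :=
  sup_le hroot.comap_le (iSup₂_le fun v hv => (hξ v hv).comap_le)

theorem measurable_type_S_lineageSigma (u : List ℕ) :
    Measurable[B.lineageSigma u] (B.type u) ∧ Measurable[B.lineageSigma u] (B.S u) :=
  B.measurable_type_S _ (B.measurable_rootType_lineageSigma u) u fun _ hv _ =>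
    B.measurable_ξ_lineageSigma hv

theorem sigmaF_le (t : ℝ≥0) : B.sigmaF t ≤ mΩ := by
  refine MeasurableSpace.generateFrom_le ?_
  rintro _ ⟨u, A, hA, rfl⟩
  exact (B.lineageSigma_le_of_measurable mΩ B.measurable_rootType u
    (fun v _ => B.measurable_ξ v) A hA).inter (measurableSet_le (B.measurable_S u) measurable_const)

theorem sigmaF_mono {s t : ℝ≥0} (h : s ≤ t) : B.sigmaF s ≤ B.sigmaF t := by
  refine MeasurableSpace.generateFrom_le ?_
  rintro _ ⟨u, A, hA, rfl⟩
  refine MeasurableSpace.measurableSet_generateFrom ⟨u, A ∩ {ω | B.S u ω ≤ (s : ℝ≥0∞)}, ?_, ?_⟩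
  · exact hA.inter ((B.measurable_type_S_lineageSigma u).2 measurableSet_Iic)
  · ext ω
    simp only [Set.mem_inter_iff, Set.mem_ofPred_eq]
    exact ⟨fun h1 => ⟨h1, h1.2.trans (ENNReal.coe_le_coe.2 h)⟩, fun h1 => h1.1⟩

/-- The σ-algebras `F_t`, bundled as a filtration. -/
def filtration : Filtration ℝ≥0 mΩ where
  seq := B.sigmaF
  mono' _ _ h := B.sigmaF_mono h
  le' := B.sigmaF_le

/-- A random variable that depends on the lineage of `u` only and vanishes unless `u` is born by
time `t` is known at time `t`. -/
theorem measurable_sigmaF {u : List ℕ} {t : ℝ≥0} {f : Ω → ℂ} (hf : Measurable[B.lineageSigma u] f)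
    (h0 : ∀ ω, (t : ℝ≥0∞) < B.S u ω → f ω = 0) : Measurable[B.sigmaF t] f := by
  have hgen : ∀ A, MeasurableSet[B.lineageSigma u] A →
      MeasurableSet[B.sigmaF t] (A ∩ {ω | B.S u ω ≤ (t : ℝ≥0∞)}) := fun A hA =>
    MeasurableSpace.measurableSet_generateFrom ⟨u, A, hA, rfl⟩
  have hS : MeasurableSet[B.sigmaF t] {ω | B.S u ω ≤ (t : ℝ≥0∞)} := by
    have := hgen Set.univ MeasurableSet.univ
    rwa [Set.univ_inter] at this
  intro s hs
  have hsplit : f ⁻¹' s = (f ⁻¹' s ∩ {ω | B.S u ω ≤ (t : ℝ≥0∞)}) ∪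
      ({ω | B.S u ω ≤ (t : ℝ≥0∞)}ᶜ ∩ {_ω | (0 : ℂ) ∈ s}) := by
    ext ω
    by_cases hω : B.S u ω ≤ (t : ℝ≥0∞)
    · simp [hω]
    · simp [hω, h0 ω (not_le.1 hω)]
  rw [hsplit]
  exact (hgen _ (hf hs)).union (hS.compl.inter (MeasurableSet.const _))

/-! ### Independence of the offspring of an individual and of the rest of the tree -/

/-- The information carried by the type of the ancestor and by the offspring process matrices of all
individuals other than `u`. -/
@[reducible] def othersSigma (u : List ℕ) : MeasurableSpace Ω :=
  MeasurableSpace.comap B.rootType inferInstance ⊔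
    ⨆ (v : List ℕ) (_ : v ∈ ({u}ᶜ : Set (List ℕ))), MeasurableSpace.comap (B.ξ v) inferInstance

theorem othersSigma_le (u : List ℕ) : B.othersSigma u ≤ mΩ :=
  sup_le B.measurable_rootType.comap_le (iSup₂_le fun v _ => (B.measurable_ξ v).comap_le)

theorem measurable_rootType_othersSigma (u : List ℕ) :
    Measurable[B.othersSigma u] B.rootType :=
  (comap_measurable B.rootType).mono le_sup_left le_rfl

theorem measurable_ξ_othersSigma {u v : List ℕ} (h : v ≠ u) :
    Measurable[B.othersSigma u] (B.ξ v) :=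
  (comap_measurable (B.ξ v)).mono
    ((le_iSup₂ (f := fun (v : List ℕ) (_ : v ∈ ({u}ᶜ : Set (List ℕ))) =>
      MeasurableSpace.comap (B.ξ v) inferInstance) v h).trans le_sup_right) le_rfl

theorem measurable_type_S_othersSigma (u : List ℕ) :
    Measurable[B.othersSigma u] (B.type u) ∧ Measurable[B.othersSigma u] (B.S u) :=
  B.measurable_type_S _ (B.measurable_rootType_othersSigma u) u fun _ _ hv =>
    B.measurable_ξ_othersSigma hv

/-- Before the birth of `u`, the process does not depend on the offspring of `u`. -/
theorem measurableSet_othersSigma_inter {u : List ℕ} {s : ℝ≥0} {E : Set Ω}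
    (hE : MeasurableSet[B.sigmaF s] E) :
    MeasurableSet[B.othersSigma u] (E ∩ {ω | (s : ℝ≥0∞) < B.S u ω}) := by
  have hS : MeasurableSet[B.othersSigma u] {ω | (s : ℝ≥0∞) < B.S u ω} :=
    (B.measurable_type_S_othersSigma u).2 measurableSet_Ioi
  induction E, hE using MeasurableSpace.generateFrom_induction with
  | hC E hE =>
    obtain ⟨v, A, hA, rfl⟩ := hE
    by_cases huv : u <:+ v
    -- a descendant of `u` is not born before `u`
    · convert MeasurableSet.empty
      refine Set.eq_empty_of_forall_notMem fun ω hω => ?_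
      exact absurd (hω.2.trans_le ((B.S_mono huv ω).trans hω.1.2)) (lt_irrefl _)
    · have hle : B.lineageSigma v ≤ B.othersSigma u :=
        B.lineageSigma_le_of_measurable _ (B.measurable_rootType_othersSigma u) v fun w hw =>
          B.measurable_ξ_othersSigma fun h => huv (h ▸ hw)
      exact (hle _ (hA.inter ((B.measurable_type_S_lineageSigma v).2 measurableSet_Iic))).inter hS
  | empty => simp
  | compl E _ ih =>
    have : Eᶜ ∩ {ω | (s : ℝ≥0∞) < B.S u ω} = {ω | (s : ℝ≥0∞) < B.S u ω} \
        (E ∩ {ω | (s : ℝ≥0∞) < B.S u ω}) := by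
      ext ω
      simp only [Set.mem_inter_iff, Set.mem_compl_iff, Set.mem_sdiff]
      tauto
    rw [this]
    exact hS.diff ih
  | iUnion E _ ih =>
    rw [Set.iUnion_inter]
    exact MeasurableSet.iUnion ih

end Branching

theorem indep_sup_left {Ω : Type*} {mΩ : MeasurableSpace Ω} {P : Measure Ω} [IsProbabilityMeasure P]
    {m₁ m₂ m₃ : MeasurableSpace Ω} (h₁ : m₁ ≤ mΩ) (h₂ : m₂ ≤ mΩ) (h₃ : m₃ ≤ mΩ)
    (h : Indep m₁ (m₂ ⊔ m₃) P) (h' : Indep m₂ m₃ P) : Indep (m₁ ⊔ m₂) m₃ P := by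
  refine IndepSets.indep (sup_le h₁ h₂) h₃
    (p1 := {E | ∃ a b, MeasurableSet[m₁] a ∧ MeasurableSet[m₂] b ∧ E = a ∩ b})
    (p2 := {E | MeasurableSet[m₃] E}) ?_ (@MeasurableSpace.isPiSystem_measurableSet _ m₃) ?_
    (@MeasurableSpace.generateFrom_measurableSet Ω m₃).symm ?_
  · rintro _ ⟨a, b, ha, hb, rfl⟩ _ ⟨a', b', ha', hb', rfl⟩ -
    exact ⟨a ∩ a', b ∩ b', ha.inter ha', hb.inter hb', Set.inter_inter_inter_comm _ _ _ _⟩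
  · refine le_antisymm (sup_le (fun a ha => ?_) fun b hb => ?_) ?_
    · exact MeasurableSpace.measurableSet_generateFrom
        ⟨a, Set.univ, ha, MeasurableSet.univ, (Set.inter_univ a).symm⟩
    · exact MeasurableSpace.measurableSet_generateFrom
        ⟨Set.univ, b, MeasurableSet.univ, hb, (Set.univ_inter b).symm⟩
    · refine MeasurableSpace.generateFrom_le ?_
      rintro _ ⟨a, b, ha, hb, rfl⟩
      have h1 : m₁ ≤ m₁ ⊔ m₂ := le_sup_left
      have h2 : m₂ ≤ m₁ ⊔ m₂ := le_sup_right
      exact MeasurableSet.inter (h1 _ ha) (h2 _ hb)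
  · rw [IndepSets_iff]
    rintro _ c ⟨a, b, ha, hb, rfl⟩ hc
    rw [Indep_iff] at h h'
    have h2 : m₂ ≤ m₂ ⊔ m₃ := le_sup_left
    have h3 : m₃ ≤ m₂ ⊔ m₃ := le_sup_right
    rw [Set.inter_assoc, h a _ ha (MeasurableSet.inter (h2 _ hb) (h3 _ hc)), h' b c hb hc,
      h a b ha (h2 _ hb), mul_assoc]

namespace Branching

variable {Ω : Type*} [mΩ : MeasurableSpace Ω] {p : ℕ} {P : Measure Ω} (B : Branching p P)

theorem indep_othersSigma [IsProbabilityMeasure P] (u : List ℕ) :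
    Indep (B.othersSigma u) (MeasurableSpace.comap (B.ξ u) inferInstance) P := by
  have hm : ∀ v, MeasurableSpace.comap (B.ξ v) inferInstance ≤ mΩ := fun v =>
    (B.measurable_ξ v).comap_le
  refine indep_sup_left B.measurable_rootType.comap_le (iSup₂_le fun v _ => hm v) (hm u) ?_ ?_
  · have h := (IndepFun_iff_Indep _ _ _).1 B.indep_rootType
    refine indep_of_indep_of_le_right h ?_
    have hle : ∀ v, MeasurableSpace.comap (B.ξ v) inferInstance ≤
        MeasurableSpace.comap (fun ω u => B.ξ u ω) MeasurableSpace.pi := fun v =>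
      ((measurable_pi_apply v).comp (comap_measurable fun ω u => B.ξ u ω)).comap_le
    exact sup_le (iSup₂_le fun v _ => hle v) (hle u)
  · have h := indep_iSup_of_disjoint hm ((iIndepFun_iff_iIndep _ _ _).1 B.indep)
      (S := {u}ᶜ) (T := {u}) disjoint_compl_left
    simpa using h

end Branching

/-! ### The matrices `exp(λ, x)` -/

section ExpMat

variable {p k : ℕ} (lam : ℂ)

theorem expMat_apply (x : ℝ) (a b : Fin k) : expMat k lam x a b =
    if a ≤ b then Complex.exp (lam * (x : ℂ)) *
        ((x : ℂ) ^ ((b : ℕ) - (a : ℕ)) / (Nat.factorial ((b : ℕ) - (a : ℕ)) : ℂ))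
    else 0 := rfl

theorem expMat_zero : expMat k lam 0 = 1 := by
  ext a b
  rw [expMat_apply, Matrix.one_apply]
  by_cases hab : a = b
  · simp [hab]
  · have h1 : (a : ℕ) ≠ b := fun h => hab (Fin.ext h)
    rw [if_neg hab]
    split_ifs with h
    · have : (b : ℕ) - a ≠ 0 := by have : (a : ℕ) ≤ b := h; omega
      simp [this]
    · rfl

/-- The functional equation of `exp(λ, ·)` is the binomial theorem. -/
theorem expMat_add (x y : ℝ) : expMat k lam (x + y) = expMat k lam x * expMat k lam y := by
  ext a b
  rw [Matrix.mul_apply]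
  simp only [expMat_apply]
  by_cases hab : a ≤ b
  · have hab' : (a : ℕ) ≤ b := hab
    rw [if_pos hab]
    have hterm : ∀ c : Fin k, ((if a ≤ c then Complex.exp (lam * (x : ℂ)) *
        ((x : ℂ) ^ ((c : ℕ) - (a : ℕ)) / (Nat.factorial ((c : ℕ) - (a : ℕ)) : ℂ)) else 0) *
        if c ≤ b then Complex.exp (lam * (y : ℂ)) *
        ((y : ℂ) ^ ((b : ℕ) - (c : ℕ)) / (Nat.factorial ((b : ℕ) - (c : ℕ)) : ℂ)) else 0) =
        (fun c : ℕ => if c ∈ Finset.Icc (a : ℕ) b then Complex.exp (lam * (x : ℂ)) *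
          Complex.exp (lam * (y : ℂ)) * ((x : ℂ) ^ (c - (a : ℕ)) / (Nat.factorial (c - (a : ℕ)) : ℂ) *
          ((y : ℂ) ^ ((b : ℕ) - c) / (Nat.factorial ((b : ℕ) - c) : ℂ))) else 0) c := fun c => by
      have h1 : a ≤ c ↔ (a : ℕ) ≤ c := Iff.rfl
      have h2 : c ≤ b ↔ (c : ℕ) ≤ b := Iff.rfl
      simp only [h1, h2, Finset.mem_Icc]
      by_cases h3 : (a : ℕ) ≤ c <;> by_cases h4 : (c : ℕ) ≤ b <;> simp [h3, h4]
      ring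
    rw [Finset.sum_congr rfl fun c _ => hterm c, Fin.sum_univ_eq_sum_range (fun c : ℕ =>
      if c ∈ Finset.Icc (a : ℕ) b then Complex.exp (lam * (x : ℂ)) *
          Complex.exp (lam * (y : ℂ)) * ((x : ℂ) ^ (c - (a : ℕ)) / (Nat.factorial (c - (a : ℕ)) : ℂ) *
          ((y : ℂ) ^ ((b : ℕ) - c) / (Nat.factorial ((b : ℕ) - c) : ℂ))) else 0) k,
      Finset.sum_ite_mem]
    have hinter : Finset.range k ∩ Finset.Icc (a : ℕ) b = Finset.Ico (a : ℕ) (b + 1) := by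
      ext c
      have := b.2
      simp only [Finset.mem_inter, Finset.mem_range, Finset.mem_Icc, Finset.mem_Ico]
      omega
    rw [hinter, Finset.sum_Ico_eq_sum_range, ← Finset.mul_sum]
    push_cast
    rw [mul_add, Complex.exp_add]
    congr 1
    obtain ⟨n, hn⟩ := Nat.exists_eq_add_of_le hab'
    rw [hn, show (a : ℕ) + n + 1 - a = n + 1 by omega, show (a : ℕ) + n - a = n by omega, add_pow,
      Finset.sum_div]
    refine Finset.sum_congr rfl fun i hi => ?_
    have hin : i ≤ n := by simpa [Nat.lt_succ_iff] using hi
    rw [show (a : ℕ) + i - a = i by omega, show (a : ℕ) + n - (a + i) = n - i by omega,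
      Nat.cast_choose ℂ hin]
    have h1 : ((n.factorial : ℕ) : ℂ) ≠ 0 := by exact_mod_cast n.factorial_ne_zero
    have h2 : ((i.factorial : ℕ) : ℂ) ≠ 0 := by exact_mod_cast i.factorial_ne_zero
    have h3 : (((n - i).factorial : ℕ) : ℂ) ≠ 0 := by exact_mod_cast (n - i).factorial_ne_zero
    field_simp
  · rw [if_neg hab]
    symm
    refine Finset.sum_eq_zero fun c _ => ?_
    by_cases h1 : a ≤ c
    · rw [if_neg (fun h2 : c ≤ b => hab (h1.trans h2)), mul_zero]
    · rw [if_neg h1, zero_mul]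

theorem continuous_expMat (a b : Fin k) : Continuous fun x => expMat k lam x a b := by
  simp only [expMat_apply]
  split_ifs
  · fun_prop
  · exact continuous_const

theorem kronRow_apply (M : Matrix (Fin k) (Fin k) ℂ) (j : Fin p) (a : Fin k)
    (x : Fin k × Fin p) : kronRow M j a x = if x.2 = j then M a x.1 else 0 := by
  simp [kronRow, rowVec, Matrix.kroneckerMap_apply, Pi.single_apply]

theorem mul_kronRow (M N : Matrix (Fin k) (Fin k) ℂ) (j : Fin p) :
    M * kronRow N j = kronRow (M * N) j := by
  ext a x
  rw [Matrix.mul_apply, kronRow_apply]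
  simp only [kronRow_apply]
  split_ifs
  · rw [Matrix.mul_apply]
  · simp

theorem kronRow_one_mul_apply {q : Type*} (N : Matrix (Fin k × Fin p) q ℂ) (j : Fin p) (a : Fin k)
    (x : q) : (kronRow (1 : Matrix (Fin k) (Fin k) ℂ) j * N) a x = N (a, j) x := by
  rw [Matrix.mul_apply, Finset.sum_eq_single (a, j)]
  · simp [kronRow_apply]
  · rintro ⟨b, l⟩ - hne
    rw [kronRow_apply]
    by_cases hl : l = j
    · have hb : a ≠ b := by rintro rfl; exact hne (by rw [hl])
      simp [hb]
    · simp [hl]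
  · simp

theorem hasSum_matrix_mul_mul {ι : Type*} {l m n o : Type*} [Fintype m] [Fintype n]
    {f : ι → Matrix m n ℂ} {s : Matrix m n ℂ} (hf : HasSum f s) (M : Matrix l m ℂ)
    (N : Matrix n o ℂ) : HasSum (fun i => M * f i * N) (M * s * N) := by
  let g : Matrix m n ℂ →+ Matrix l o ℂ :=
    { toFun := fun x => M * x * N
      map_zero' := by simp
      map_add' := fun x y => by rw [Matrix.mul_add, Matrix.add_mul] }
  have hg : Continuous g :=
    (continuous_const.matrix_mul continuous_id).matrix_mul continuous_const
  exact hf.map g hg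

open Classical in
/-- Summing `F ⊗ e_j` over the children of an individual of type `i` amounts to selecting the rows of
type `i` of the matrix integral of `F` against the offspring processes. -/
theorem hasSum_children_kronRow {ξ : Fin p → Fin p → Measure ℝ≥0}
    (h : ∀ i j, IsPointMeasure (ξ i j)) (i : Fin p) {F : ℝ≥0 → Matrix (Fin k) (Fin k) ℂ}
    (hF : ∀ j a b, Integrable (fun s => F s a b) (ξ i j)) :
    HasSum (fun n : ℕ => if pointTime (∑ l, ξ i l) n = ⊤ then 0 else
      kronRow (F (pointTime (∑ l, ξ i l) n).toNNReal) (childType i (ξ i) n))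
      (kronRow (1 : Matrix (Fin k) (Fin k) ℂ) i * kronIntegral F ξ) := by
  have key : ∀ (a : Fin k) (x : Fin k × Fin p), HasSum (fun n : ℕ =>
      (if pointTime (∑ l, ξ i l) n = ⊤ then 0 else kronRow (F (pointTime (∑ l, ξ i l) n).toNNReal)
        (childType i (ξ i) n) : Matrix (Fin k) (Fin k × Fin p) ℂ) a x)
      ((kronRow (1 : Matrix (Fin k) (Fin k) ℂ) i * kronIntegral F ξ) a x) := fun a x => by
    have hsum := hasSum_children_integral (h i) i
      (f := fun j s => if x.2 = j then F s a x.1 else 0) fun j => by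
        by_cases hj : x.2 = j
        · simpa [hj] using hF j a x.1
        · simp [hj]
    have hval : (kronRow (1 : Matrix (Fin k) (Fin k) ℂ) i * kronIntegral F ξ) a x =
        ∑ j, ∫ s, (if x.2 = j then F s a x.1 else 0) ∂(ξ i j) := by
      rw [kronRow_one_mul_apply, Finset.sum_eq_single x.2]
      · simp [kronIntegral]
      · intro j _ hj
        simp [hj.symm]
      · simp
    rw [hval]
    refine hsum.congr_fun fun n => ?_
    split_ifs <;> simp_all [kronRow_apply]
  exact Pi.hasSum.2 fun a => Pi.hasSum.2 fun x => key a x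

theorem measurable_integral_expMat {α : Type*} {mα : MeasurableSpace α} {ν : α → Measure ℝ≥0}
    (hν : Measurable ν) (h : ∀ a, IsPointMeasure (ν a)) {r : α → ℝ} (hr : Measurable r)
    (x y : Fin k) : Measurable fun a => ∫ s : ℝ≥0, (if r a < (s : ℝ) then
      expMat k lam (r a - (s : ℝ)) else 0) x y ∂(ν a) := by
  classical
  refine measurable_integral_of_isPointMeasure hν h ?_
  have hs : Measurable fun q : α × ℝ≥0 => (q.2 : ℝ) := measurable_snd.coe_nnreal_real
  have hr' : Measurable fun q : α × ℝ≥0 => r q.1 := hr.comp measurable_fst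
  have heq : (Function.uncurry fun a (s : ℝ≥0) => (if r a < (s : ℝ) then
      expMat k lam (r a - (s : ℝ)) else 0) x y) = fun q : α × ℝ≥0 =>
      if r q.1 < (q.2 : ℝ) then expMat k lam (r q.1 - (q.2 : ℝ)) x y else 0 := by
    funext q
    simp only [Function.uncurry]
    split_ifs <;> rfl
  rw [heq]
  exact Measurable.ite (measurableSet_lt hr' hs)
    ((continuous_expMat lam x y).measurable.comp (hr'.sub hs)) measurable_const

end ExpMat

namespace Branching

section Adapted

/-! ### The process is adapted -/

theorem measurable_contribution_aux {α : Type*} {mα : MeasurableSpace α} {p k : ℕ} (lam : ℂ)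
    {ξ : α → Fin p → Fin p → Measure ℝ≥0} (hξ : Measurable ξ)
    (h : ∀ a i j, IsPointMeasure (ξ a i j)) {τ : α → Fin p} (hτ : Measurable τ)
    {r : α → ℝ} (hr : Measurable r) (A : Matrix (Fin k × Fin p) (Fin p) ℂ) (a : Fin k)
    (j : Fin p) : Measurable fun ω => (kronRow (1 : Matrix (Fin k) (Fin k) ℂ) (τ ω) * (kronIntegral
      (fun s : ℝ≥0 => if r ω < (s : ℝ) then expMat k lam (r ω - (s : ℝ)) else 0) (ξ ω) * A)) a j := by
  simp only [kronRow_one_mul_apply]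
  refine measurable_apply_of_countable (f := fun i ω => (kronIntegral
      (fun s : ℝ≥0 => if r ω < (s : ℝ) then expMat k lam (r ω - (s : ℝ)) else 0) (ξ ω) * A) (a, i) j)
      (fun i => ?_) hτ
  simp only [Matrix.mul_apply]
  refine Finset.measurable_sum _ fun x _ => Measurable.mul_const ?_ _
  exact measurable_integral_expMat lam (measurable_pi_iff.1 (measurable_pi_iff.1 hξ i) x.2)
    (fun ω => h ω i x.2) hr a x.1

theorem contribution_of_S_eq_top {Ω : Type*} [MeasurableSpace Ω] {p : ℕ} {P : Measure Ω}
    (B : Branching p P) {lam : ℂ} {t : ℝ≥0} {u : List ℕ} {ω : Ω} (h : B.S u ω = ⊤) :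
    B.contribution lam t u ω = 0 := by
  rw [contribution, if_pos h]

open Classical in
theorem contribution_of_S_ne_top {Ω : Type*} [MeasurableSpace Ω] {p : ℕ} {P : Measure Ω}
    (B : Branching p P) {lam : ℂ} {t : ℝ≥0} {u : List ℕ} {ω : Ω} (h : B.S u ω ≠ ⊤) :
    B.contribution lam t u ω = if 0 ≤ (t : ℝ) - (B.S u ω).toReal then
      kronRow (1 : Matrix (Fin (B.kOrd lam)) (Fin (B.kOrd lam)) ℂ) (B.type u ω) * (kronIntegral
        (fun s : ℝ≥0 => if (t : ℝ) - (B.S u ω).toReal < (s : ℝ) then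
          expMat (B.kOrd lam) lam ((t : ℝ) - (B.S u ω).toReal - (s : ℝ)) else 0) (B.ξ u ω) *
          B.vecA lam) else 0 := by
  have h1 : B.contribution lam t u ω =
      kronRow (1 : Matrix (Fin (B.kOrd lam)) (Fin (B.kOrd lam)) ℂ) (B.type u ω) *
        B.phi lam u ω ((t : ℝ) - (B.S u ω).toReal) := by
    rw [contribution, if_neg h]
    rfl
  rw [h1, phi]
  split_ifs with h0
  · congr!
  · rw [Matrix.mul_zero]

theorem measurable_contribution_of {Ω : Type*} (m : MeasurableSpace Ω) [mΩ : MeasurableSpace Ω]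
    {p : ℕ} {P : Measure Ω} (B : Branching p P) (lam : ℂ) (t : ℝ≥0) (u : List ℕ)
    (hξ : Measurable[m] (B.ξ u)) (hτ : Measurable[m] (B.type u)) (hS : Measurable[m] (B.S u))
    (a : Fin (B.kOrd lam)) (j : Fin p) :
    Measurable[m] fun ω => B.contribution lam t u ω a j := by
  classical
  have hr : Measurable[m] fun ω => (t : ℝ) - (B.S u ω).toReal :=
    measurable_const.sub hS.ennreal_toReal
  have haux := measurable_contribution_aux lam hξ (B.isPointMeasure u) hτ hr (B.vecA lam) a j
  have heq : (fun ω => B.contribution lam t u ω a j) = fun ω => if B.S u ω = ⊤ then 0 else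
      if 0 ≤ (t : ℝ) - (B.S u ω).toReal then
        (kronRow (1 : Matrix (Fin (B.kOrd lam)) (Fin (B.kOrd lam)) ℂ) (B.type u ω) * (kronIntegral
      (fun s : ℝ≥0 => if (t : ℝ) - (B.S u ω).toReal < (s : ℝ) then
        expMat (B.kOrd lam) lam ((t : ℝ) - (B.S u ω).toReal - (s : ℝ)) else 0) (B.ξ u ω) *
          B.vecA lam)) a j else 0 := by
    funext ω
    by_cases htop : B.S u ω = ⊤
    · rw [B.contribution_of_S_eq_top htop, if_pos htop]
      rfl
    · rw [B.contribution_of_S_ne_top htop, if_neg htop]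
      split_ifs
      · rfl
      · rfl
  rw [heq]
  exact Measurable.ite (hS (measurableSet_singleton ⊤)) measurable_const
    (Measurable.ite (measurableSet_le measurable_const hr) haux measurable_const)

variable {Ω : Type*} [mΩ : MeasurableSpace Ω] {p : ℕ} {P : Measure Ω} (B : Branching p P)

theorem contribution_eq_zero_of_lt {lam : ℂ} {t : ℝ≥0} {u : List ℕ} {ω : Ω}
    (h : (t : ℝ≥0∞) < B.S u ω) : B.contribution lam t u ω = 0 := by
  by_cases htop : B.S u ω = ⊤
  · exact B.contribution_of_S_eq_top htop
  · have : ¬ (0 ≤ (t : ℝ) - (B.S u ω).toReal) := by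
      rw [sub_nonneg, not_le]
      have := (ENNReal.toReal_lt_toReal ENNReal.coe_ne_top htop).2 h
      simpa using this
    rw [B.contribution_of_S_ne_top htop, if_neg this]

theorem measurable_contribution (lam : ℂ) (t : ℝ≥0) (u : List ℕ)
    (a : Fin (B.kOrd lam)) (j : Fin p) :
    Measurable[B.sigmaF t] fun ω => B.contribution lam t u ω a j := by
  refine B.measurable_sigmaF (u := u) ?_ fun ω hω => by
    rw [B.contribution_eq_zero_of_lt hω]; rfl
  exact measurable_contribution_of (B.lineageSigma u) B lam t u
    (B.measurable_ξ_lineageSigma List.suffix_rfl) (B.measurable_type_S_lineageSigma u).1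
    (B.measurable_type_S_lineageSigma u).2 a j

theorem measurable_tsum_matrix {α ι : Type*} {mα : MeasurableSpace α} [Countable ι] {m n : Type*}
    [Fintype m] [Fintype n] {f : ι → α → Matrix m n ℂ}
    (hf : ∀ i a b, Measurable fun x => f i x a b) (a : m) (b : n) :
    Measurable fun x => (∑' i, f i x) a b := by
  have h : Measurable fun x => ∑' i, (fun a b => f i x a b : m → n → ℂ) :=
    Measurable.tsum fun i => measurable_pi_iff.2 fun a => measurable_pi_iff.2 fun b => hf i a b
  exact measurable_pi_iff.1 (measurable_pi_iff.1 h a) b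

theorem stronglyMeasurable_W (lam : ℂ) (t : ℝ≥0) (a : Fin (B.kOrd lam)) (j : Fin p) :
    StronglyMeasurable[B.sigmaF t] fun ω => B.W lam t ω a j := by
  refine Measurable.stronglyMeasurable ?_
  simp only [W, Matrix.mul_apply]
  refine Finset.measurable_sum _ fun x _ => Measurable.const_mul ?_ _
  exact measurable_tsum_matrix (fun u a b => B.measurable_contribution lam t u a b) x j

end Adapted

end Branching

/-! ### Pathwise representation of the process -/

/-- A sum over all children of the members of a finite set `T` of individuals may be computed parent
by parent. -/
theorem hasSum_of_hasSum_children {M : Type*} [AddCommMonoid M] [TopologicalSpace M] [ContinuousAdd M]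
    (T : Finset (List ℕ)) {g c : List ℕ → M} (h : ∀ u ∈ T, HasSum (fun n => g (n :: u)) (c u))
    (hg : ∀ w, g w ≠ 0 → w ≠ [] ∧ w.tail ∈ T) : HasSum g (∑ u ∈ T, c u) := by
  classical
  have h1 : ∀ u ∈ T, HasSum (fun w => if w ≠ [] ∧ w.tail = u then g w else 0) (c u) := fun u hu => by
    have hinj : Function.Injective fun n : ℕ => n :: u := fun m n hmn => (List.cons.inj hmn).1
    refine (hinj.hasSum_iff fun w hw => if_neg ?_).1 ?_
    · rintro ⟨hne, rfl⟩
      exact hw ⟨w.head hne, List.cons_head_tail hne⟩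
    · convert h u hu using 2 with n
      simp
  convert hasSum_sum h1 using 2 with w
  by_cases hw : g w = 0
  · simp [hw]
  · obtain ⟨hne, hT⟩ := hg w hw
    rw [Finset.sum_eq_single_of_mem _ hT]
    · simp [hne]
    · intro u _ hu
      rw [if_neg]
      exact fun hc => hu hc.2.symm

namespace Branching

variable {Ω : Type*} [mΩ : MeasurableSpace Ω] {p : ℕ} {P : Measure Ω} (B : Branching p P)

/-- The term `(exp(λ, -S(u)) ⊗ e_{τ(u)}) A_λ` by which the individual `u` contributes to the sum over
the coming generation. -/
noncomputable def psi (lam : ℂ) (u : List ℕ) (ω : Ω) : Matrix (Fin (B.kOrd lam)) (Fin p) ℂ :=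
  kronRow (expMat (B.kOrd lam) lam (-(B.S u ω).toReal)) (B.type u ω) * B.vecA lam

/-- The matrix `∫ exp(λ, -s) ⊗ ξ_u(ds)`. -/
noncomputable def childMat (lam : ℂ) (u : List ℕ) (ω : Ω) :
    Matrix (Fin (B.kOrd lam) × Fin p) (Fin (B.kOrd lam) × Fin p) ℂ :=
  kronIntegral (fun s : ℝ≥0 => expMat (B.kOrd lam) lam (-(s : ℝ))) (B.ξ u ω)

/-- What is gained, in the sum over the coming generation, when the individual `u` is replaced by its
children. -/
noncomputable def increment (lam : ℂ) (u : List ℕ) (ω : Ω) : Matrix (Fin (B.kOrd lam)) (Fin p) ℂ :=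
  expMat (B.kOrd lam) lam (-(B.S u ω).toReal) *
    (kronRow (1 : Matrix (Fin (B.kOrd lam)) (Fin (B.kOrd lam)) ℂ) (B.type u ω) *
      (B.childMat lam u ω * B.vecA lam - B.vecA lam))

/-- The outcomes for which all sums over children converge absolutely and only finitely many
individuals are born in bounded time. -/
structure IsRegular (lam : ℂ) (ω : Ω) : Prop where
  integrable : ∀ u i j a b,
    Integrable (fun s : ℝ≥0 => expMat (B.kOrd lam) lam (-(s : ℝ)) a b) (B.ξ u ω i j)
  finite : ∀ t : ℝ≥0, {u | B.S u ω ≤ t}.Finite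

variable {B} {lam : ℂ} {ω : Ω}

theorem toReal_S_cons {u : List ℕ} {n : ℕ} (h : B.S (n :: u) ω ≠ ⊤) :
    (B.S (n :: u) ω).toReal = (B.S u ω).toReal + ((B.X u n ω).toNNReal : ℝ) := by
  rw [S, ENNReal.add_ne_top] at h
  rw [S, ENNReal.toReal_add h.1 h.2]
  rfl

theorem psi_cons {u : List ℕ} {n : ℕ} (h : B.S (n :: u) ω ≠ ⊤) :
    B.psi lam (n :: u) ω = expMat (B.kOrd lam) lam (-(B.S u ω).toReal) *
      kronRow (expMat (B.kOrd lam) lam (-((B.X u n ω).toNNReal : ℝ))) (B.type (n :: u) ω) *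
        B.vecA lam := by
  rw [psi, toReal_S_cons h, neg_add, expMat_add, mul_kronRow]

theorem S_cons_ne_top_iff {u : List ℕ} {n : ℕ} (hu : B.S u ω ≠ ⊤) :
    B.S (n :: u) ω ≠ ⊤ ↔ B.X u n ω ≠ ⊤ := by
  rw [S, ENNReal.add_ne_top, and_iff_right hu]

open Classical in
theorem hasSum_psi_children (h : B.IsRegular lam ω) {u : List ℕ} (hu : B.S u ω ≠ ⊤) :
    HasSum (fun n : ℕ => if B.S (n :: u) ω = ⊤ then 0 else B.psi lam (n :: u) ω)
      (B.increment lam u ω + B.psi lam u ω) := by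
  have h1 := hasSum_matrix_mul_mul (hasSum_children_kronRow (B.isPointMeasure u ω) (B.type u ω)
    (F := fun s : ℝ≥0 => expMat (B.kOrd lam) lam (-(s : ℝ)))
    fun j a b => h.integrable u (B.type u ω) j a b)
    (expMat (B.kOrd lam) lam (-(B.S u ω).toReal)) (B.vecA lam)
  have hval : B.increment lam u ω + B.psi lam u ω =
      expMat (B.kOrd lam) lam (-(B.S u ω).toReal) *
        (kronRow (1 : Matrix (Fin (B.kOrd lam)) (Fin (B.kOrd lam)) ℂ) (B.type u ω) *
        kronIntegral (fun s : ℝ≥0 => expMat (B.kOrd lam) lam (-(s : ℝ))) (B.ξ u ω)) * B.vecA lam := by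
    rw [increment, psi, childMat, Matrix.mul_sub, Matrix.mul_sub, ← Matrix.mul_assoc,
      ← Matrix.mul_assoc, ← Matrix.mul_assoc (expMat _ _ _) _ (B.vecA lam), mul_kronRow, mul_one,
      sub_add_cancel, ← Matrix.mul_assoc, mul_kronRow, mul_one]
  rw [hval]
  refine h1.congr_fun fun n => ?_
  have hX : pointTime (∑ l, B.ξ u ω (B.type u ω) l) n = B.X u n ω := rfl
  rw [hX]
  by_cases hn : B.X u n ω = ⊤
  · rw [if_pos (by_contra fun hc => (S_cons_ne_top_iff hu).1 hc hn), if_pos hn]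
    simp
  · rw [if_neg ((S_cons_ne_top_iff hu).2 hn), if_neg hn, psi_cons ((S_cons_ne_top_iff hu).2 hn)]
    rfl

theorem mem_coming_cons {t : ℝ≥0} {u : List ℕ} {n : ℕ} : n :: u ∈ B.coming t ω ↔
    B.S (n :: u) ω ≠ ⊤ ∧ B.S u ω ≤ t ∧ t < B.S (n :: u) ω := by
  constructor
  · rintro ⟨v, m, hv, h1, h2, h3⟩
    obtain ⟨rfl, rfl⟩ := List.cons.inj hv
    exact ⟨(B.isBorn_iff _ _).1 h1, h2, h3⟩
  · rintro ⟨h1, h2, h3⟩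
    exact ⟨u, n, rfl, (B.isBorn_iff _ _).2 h1, h2, h3⟩

theorem integrable_expMat_cut {u : List ℕ} (h : B.IsRegular lam ω) (r : ℝ) (i j : Fin p)
    (a b : Fin (B.kOrd lam)) : Integrable (fun s : ℝ≥0 => (if r < (s : ℝ) then
      expMat (B.kOrd lam) lam (r - (s : ℝ)) else 0) a b) (B.ξ u ω i j) := by
  have hms : MeasurableSet {s : ℝ≥0 | r < (s : ℝ)} :=
    measurableSet_lt measurable_const measurable_coe_nnreal_real
  have h1 : Integrable (fun s : ℝ≥0 => expMat (B.kOrd lam) lam (r - (s : ℝ)) a b)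
      (B.ξ u ω i j) := by
    simp only [sub_eq_add_neg, expMat_add, Matrix.mul_apply]
    exact integrable_finsetSum _ fun c _ => (h.integrable u i j c b).const_mul _
  refine (h1.indicator hms).congr (Eventually.of_forall fun s => ?_)
  simp only [Set.indicator_apply, Set.mem_ofPred_eq]
  split_ifs <;> rfl

open Classical in
/-- The contribution of `u` to `W_t` comes from those children of `u` that are born after `t`. -/
theorem hasSum_coming_children (h : B.IsRegular lam ω) {t : ℝ≥0} {u : List ℕ} (hu : B.S u ω ≤ t) :
    HasSum (fun n : ℕ => if n :: u ∈ B.coming t ω then B.psi lam (n :: u) ω else 0)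
      (expMat (B.kOrd lam) lam (-(t : ℝ)) * B.contribution lam t u ω) := by
  have htop : B.S u ω ≠ ⊤ := (hu.trans_lt ENNReal.coe_lt_top).ne
  have hr : 0 ≤ (t : ℝ) - (B.S u ω).toReal := by
    rw [sub_nonneg]
    simpa using ENNReal.toReal_mono ENNReal.coe_ne_top hu
  set r := (t : ℝ) - (B.S u ω).toReal with hrdef
  have h1 := hasSum_matrix_mul_mul (hasSum_children_kronRow (B.isPointMeasure u ω) (B.type u ω)
    (F := fun s : ℝ≥0 => if r < (s : ℝ) then expMat (B.kOrd lam) lam (r - (s : ℝ)) else 0)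
    fun j a b => integrable_expMat_cut h r (B.type u ω) j a b)
    (expMat (B.kOrd lam) lam (-(t : ℝ))) (B.vecA lam)
  rw [B.contribution_of_S_ne_top htop, if_pos hr, ← Matrix.mul_assoc, ← Matrix.mul_assoc]
  rw [← Matrix.mul_assoc] at h1
  refine h1.congr_fun fun n => ?_
  have hX : pointTime (∑ l, B.ξ u ω (B.type u ω) l) n = B.X u n ω := rfl
  rw [hX]
  by_cases hn : B.X u n ω = ⊤
  · have hS : ¬ (B.S (n :: u) ω ≠ ⊤) := fun hc => (S_cons_ne_top_iff htop).1 hc hn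
    rw [if_neg fun hc => hS (mem_coming_cons.1 hc).1, if_pos hn]
    simp
  · have hS : B.S (n :: u) ω ≠ ⊤ := (S_cons_ne_top_iff htop).2 hn
    have hlt : r < ((B.X u n ω).toNNReal : ℝ) ↔ n :: u ∈ B.coming t ω := by
      rw [mem_coming_cons, and_iff_right hS, and_iff_right hu, hrdef, sub_lt_iff_lt_add',
        ← toReal_S_cons hS]
      rw [← ENNReal.toReal_lt_toReal ENNReal.coe_ne_top hS]
      simp
    rw [if_neg hn]
    by_cases hc : n :: u ∈ B.coming t ω
    · rw [if_pos hc, if_pos (hlt.2 hc), psi_cons hS, mul_kronRow, mul_kronRow, ← expMat_add,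
        ← expMat_add]
      congr 3
      rw [hrdef]
      ring
    · rw [if_neg hc, if_neg fun hc' => hc (hlt.1 hc')]
      have : kronRow (0 : Matrix (Fin (B.kOrd lam)) (Fin (B.kOrd lam)) ℂ)
          (childType (B.type u ω) (B.ξ u ω (B.type u ω)) n) = 0 := by
        ext a x
        simp [kronRow_apply]
      rw [this]
      simp

theorem finite_contribution_ne_zero (h : B.IsRegular lam ω) (t : ℝ≥0) :
    {u | B.contribution lam t u ω ≠ 0}.Finite :=
  (h.finite t).subset fun _ hu => not_lt.1 fun hlt => hu (B.contribution_eq_zero_of_lt hlt)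

theorem W_eq_sum (h : B.IsRegular lam ω) (t : ℝ≥0) : B.W lam t ω =
    ∑ u ∈ (h.finite t).toFinset, expMat (B.kOrd lam) lam (-(t : ℝ)) * B.contribution lam t u ω := by
  rw [← Matrix.mul_sum]
  have : B.Zphi lam t ω = ∑ u ∈ (h.finite t).toFinset, B.contribution lam t u ω :=
    tsum_eq_sum fun u hu => B.contribution_eq_zero_of_lt (by simpa using hu)
  rw [W, this]

/-- The representation of `W_t` as a sum over the coming generation. -/
theorem hasSum_coming (h : B.IsRegular lam ω) (t : ℝ≥0) :
    HasSum (fun u : B.coming t ω => B.psi lam u ω) (B.W lam t ω) := by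
  classical
  rw [W_eq_sum h t]
  refine (hasSum_subtype_iff_indicator (f := fun u => B.psi lam u ω)).2 ?_
  refine hasSum_of_hasSum_children _ (fun u hu => ?_) fun w hw => ?_
  · have hu' : B.S u ω ≤ t := by simpa using hu
    exact (hasSum_coming_children h hu').congr_fun fun n => by rw [Set.indicator_apply]
  · obtain ⟨u, k, rfl, -, h1, -⟩ := Set.mem_of_indicator_ne_zero hw
    exact ⟨List.cons_ne_nil _ _, by simpa using h1⟩

/-- The coming generation at time `t` arises from the ancestor by replacing, one after the other,
the individuals born by time `t` by their children. -/
theorem W_eq_psi_add_sum_increment (h : B.IsRegular lam ω) (t : ℝ≥0) :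
    B.W lam t ω = B.psi lam [] ω + ∑ u ∈ (h.finite t).toFinset, B.increment lam u ω := by
  classical
  set T := (h.finite t).toFinset with hT
  have hmem : ∀ u, u ∈ T ↔ B.S u ω ≤ t := fun u => by simp [hT]
  have hnil : [] ∈ T := by rw [hmem]; simp [S]
  -- the sum of `ψ_w` over the individuals `w ≠ ∅` born by time `t` is computed in two ways: directly,
  -- and parent by parent
  let g : List ℕ → Matrix (Fin (B.kOrd lam)) (Fin p) ℂ := fun w =>
    if w ≠ [] ∧ w ∈ T then B.psi lam w ω else 0
  have hg : ∀ w, g w = if w ≠ [] ∧ w ∈ T then B.psi lam w ω else 0 := fun _ => rfl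
  clear_value g
  have h1 : ∀ u ∈ T, HasSum (fun n : ℕ => g (n :: u)) (B.increment lam u ω + B.psi lam u ω -
        expMat (B.kOrd lam) lam (-(t : ℝ)) * B.contribution lam t u ω) := fun u hu => by
    have hu' := (hmem u).1 hu
    have htop : B.S u ω ≠ ⊤ := (hu'.trans_lt ENNReal.coe_lt_top).ne
    refine ((hasSum_psi_children h htop).sub (hasSum_coming_children h hu')).congr_fun fun n => ?_
    rw [hg]
    by_cases hn : n :: u ∈ T
    · have hn' := (hmem _).1 hn
      rw [if_pos ⟨by simp, hn⟩, if_neg (hn'.trans_lt ENNReal.coe_lt_top).ne, if_neg, sub_zero]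
      exact fun hc => absurd (mem_coming_cons.1 hc).2.2 (not_lt.2 hn')
    · rw [if_neg fun hc => hn hc.2]
      have hn' : (t : ℝ≥0∞) < B.S (n :: u) ω := not_le.1 fun hc => hn ((hmem _).2 hc)
      by_cases hS : B.S (n :: u) ω = ⊤
      · rw [if_pos hS, if_neg fun hc => (mem_coming_cons.1 hc).1 hS, sub_zero]
      · rw [if_neg hS, if_pos (mem_coming_cons.2 ⟨hS, hu', hn'⟩), sub_self]
  have h2 := hasSum_of_hasSum_children T h1 fun w hw => by
    have hw : w ≠ [] ∧ w ∈ T := by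
      by_contra hc
      exact hw ((hg w).trans (if_neg hc))
    refine ⟨hw.1, (hmem _).2 ((B.S_mono (List.tail_suffix w) ω).trans ((hmem _).1 hw.2))⟩
  have h3 : HasSum g (∑ w ∈ T.erase [], B.psi lam w ω) := by
    have : HasSum g (∑ w ∈ T.erase [], g w) := hasSum_sum_of_ne_finset_zero fun w hw => by
        rw [hg, if_neg]
        rwa [Finset.mem_erase] at hw
    rwa [Finset.sum_congr rfl fun w hw => (hg w).trans (if_pos (Finset.mem_erase.1 hw))] at this
  have h4 := h2.unique h3
  rw [Finset.sum_sub_distrib, Finset.sum_add_distrib, ← W_eq_sum h t,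
    ← Finset.sum_erase_add T _ hnil, ← Finset.sum_erase_add T (fun u => B.psi lam u ω) hnil] at h4
  rw [← Finset.sum_erase_add T _ hnil]
  have h5 := sub_eq_iff_eq_add.1 h4
  rw [← add_right_inj (∑ w ∈ T.erase [], B.psi lam w ω), ← h5]
  abel

end Branching

/-! ### The Laplace transform for large arguments -/

section Matrix

attribute [local instance] Matrix.linftyOpNormedRing Matrix.linftyOpNormedAlgebra

theorem summable_pow_of_norm_pow_lt_one {R : Type*} [NormedRing R] [CompleteSpace R] {x : R} {N : ℕ}
    (hN : N ≠ 0) (h : ‖x ^ N‖ < 1) : Summable fun n => x ^ n := by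
  -- write the exponent as `q N + r` with `r < N`
  have : NeZero N := ⟨hN⟩
  rw [← (Nat.divModEquiv N).symm.summable_iff]
  have h1 : Summable fun q : ℕ => max 1 ‖(1 : R)‖ * ‖x ^ N‖ ^ q :=
    (summable_geometric_of_lt_one (norm_nonneg _) h).mul_left _
  have h2 : Summable fun r : Fin N => ‖x ^ (r : ℕ)‖ := Summable.of_finite
  refine Summable.of_norm_bounded (h1.mul_of_nonneg h2 (fun q => by positivity)
    fun r => norm_nonneg _) fun ⟨q, r⟩ => ?_
  have hpow : (x ^ N) ^ q * x ^ (r : ℕ) = x ^ ((Nat.divModEquiv N).symm (q, r)) := by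
    rw [← pow_mul, ← pow_add]
    congr 1
    simp [Nat.divModEquiv, add_comm, mul_comm]
  have hq : ‖(x ^ N) ^ q‖ ≤ max 1 ‖(1 : R)‖ * ‖x ^ N‖ ^ q := by
    rcases Nat.eq_zero_or_pos q with rfl | hq
    · simp
    · refine (norm_pow_le' _ hq).trans ?_
      exact le_mul_of_one_le_left (by positivity) (le_max_left _ _)
  simp only [Function.comp_apply]
  rw [← hpow]
  exact (norm_mul_le _ _).trans (mul_le_mul_of_nonneg_right hq (norm_nonneg _))

/-- By Gelfand's formula. -/
theorem exists_norm_pow_lt_one_of_spectralRadius_lt_one {p : ℕ} {A : Matrix (Fin p) (Fin p) ℂ}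
    (h : spectralRadius ℂ A < 1) : ∃ N : ℕ, N ≠ 0 ∧ ‖A ^ N‖ < 1 := by
  have : CompleteSpace (Matrix (Fin p) (Fin p) ℂ) := FiniteDimensional.complete ℂ _
  have hlim := spectrum.pow_nnnorm_pow_one_div_tendsto_nhds_spectralRadius A
  obtain ⟨N, hN, hN0⟩ := ((hlim.eventually_lt_const h).and (eventually_ne_atTop 0)).exists
  refine ⟨N, hN0, ?_⟩
  by_contra hcon
  rw [not_lt] at hcon
  have h1 : (1 : ℝ≥0∞) ≤ (‖A ^ N‖₊ : ℝ≥0∞) := by exact_mod_cast hcon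
  have h2 := ENNReal.one_le_rpow h1 (z := 1 / (N : ℝ)) (by positivity)
  exact absurd hN (not_lt.2 h2)

/-- If a family of matrices tends to a matrix of spectral radius less than `1`, then eventually
its members have convergent Neumann series. -/
theorem eventually_summable_pow {ι : Type*} {l : Filter ι} {p : ℕ}
    {M : ι → Matrix (Fin p) (Fin p) ℂ} {A : Matrix (Fin p) (Fin p) ℂ}
    (h : spectralRadius ℂ A < 1) (hM : Tendsto M l (𝓝 A)) :
    ∀ᶠ i in l, (Summable fun n => M i ^ n) ∧ (1 - M i).det ≠ 0 := by
  have : CompleteSpace (Matrix (Fin p) (Fin p) ℂ) := FiniteDimensional.complete ℂ _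
  obtain ⟨N, hN0, hN⟩ := exists_norm_pow_lt_one_of_spectralRadius_lt_one h
  filter_upwards [((hM.pow N).norm).eventually_lt_const hN] with i hi
  refine ⟨summable_pow_of_norm_pow_lt_one hN0 hi, fun hdet => ?_⟩
  have h1 := (Matrix.isUnit_iff_isUnit_det _).1 (isUnit_one_sub_of_norm_lt_one hi)
  rw [← mul_neg_geom_sum, Matrix.det_mul, hdet, zero_mul] at h1
  exact not_isUnit_zero h1

end Matrix

namespace Branching

variable {Ω : Type*} [mΩ : MeasurableSpace Ω] {p : ℕ} {P : Measure Ω} (B : Branching p P)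

theorem measurable_ξ_apply (u : List ℕ) (i j : Fin p) : Measurable fun ω => B.ξ u ω i j :=
  measurable_pi_iff.1 (measurable_pi_iff.1 (B.measurable_ξ u) i) j

/-- `∫ e^{-βx} μ^{i,j}(dx)`, as a matrix with entries in `[0, ∞]`. -/
noncomputable def lap (β : ℝ) : Matrix (Fin p) (Fin p) ℝ≥0∞ :=
  Matrix.of fun i j => ∫⁻ x : ℝ≥0, ENNReal.ofReal (Real.exp (-(β * (x : ℝ)))) ∂(B.intensity i j)

theorem mem_laplaceDom_mono {z w : ℂ} (hz : z ∈ B.laplaceDom) (h : z.re ≤ w.re) :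
    w ∈ B.laplaceDom := fun i j => by
  refine (lintegral_mono fun x => ENNReal.ofReal_le_ofReal (Real.exp_le_exp.2 ?_)).trans_lt (hz i j)
  exact neg_le_neg (mul_le_mul_of_nonneg_right h x.2)

theorem integrable_exp_of_mem_laplaceDom {z : ℂ} (hz : z ∈ B.laplaceDom) (i j : Fin p) :
    Integrable (fun x : ℝ≥0 => Real.exp (-(z.re * (x : ℝ)))) (B.intensity i j) := by
  refine ⟨by fun_prop, ?_⟩
  rw [hasFiniteIntegral_iff_ofReal (Eventually.of_forall fun x => (Real.exp_pos _).le)]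
  exact hz i j

/-- As `β → ∞`, only the offspring born immediately retains its weight. -/
theorem tendsto_laplace_atTop {z : ℂ} (hz : z ∈ B.laplaceDom) :
    Tendsto (fun β : ℝ => B.laplace (β : ℂ)) atTop
      (𝓝 (Matrix.of fun i j => (((B.intensity i j {0}).toReal : ℝ) : ℂ))) := by
  refine tendsto_pi_nhds.2 fun i => tendsto_pi_nhds.2 fun j => ?_
  have hint := B.integrable_exp_of_mem_laplaceDom hz i j
  have h0 : ∫ x : ℝ≥0, Set.indicator {0} (fun _ => (1 : ℂ)) x ∂(B.intensity i j) =
      (((B.intensity i j {0}).toReal : ℝ) : ℂ) := by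
    rw [integral_indicator_const _ (measurableSet_singleton 0)]
    simp [Measure.real]
  change Tendsto (fun β : ℝ => ∫ x : ℝ≥0, Complex.exp (-((β : ℂ) * ((x : ℝ) : ℂ)))
    ∂(B.intensity i j)) atTop (𝓝 (((B.intensity i j {0}).toReal : ℝ) : ℂ))
  rw [← h0]
  refine tendsto_integral_filter_of_dominated_convergence _
    (Eventually.of_forall fun β => by fun_prop) ?_ hint (Eventually.of_forall fun x => ?_)
  · filter_upwards [eventually_ge_atTop z.re] with β hβ
    refine Eventually.of_forall fun x => ?_
    rw [Complex.norm_exp]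
    simp only [Complex.neg_re, Complex.re_ofReal_mul, Complex.ofReal_re]
    exact Real.exp_le_exp.2 (neg_le_neg (mul_le_mul_of_nonneg_right hβ x.2))
  · by_cases hx : x = 0
    · simp [hx]
    · rw [Set.indicator_of_notMem (by simpa using hx)]
      have hxpos : 0 < (x : ℝ) := by
        have := pos_iff_ne_zero.2 hx
        exact_mod_cast this
      rw [tendsto_zero_iff_norm_tendsto_zero]
      simp only [Complex.norm_exp, Complex.neg_re, Complex.re_ofReal_mul, Complex.ofReal_re]
      exact Real.tendsto_exp_atBot.comp
        (tendsto_neg_atTop_atBot.comp (tendsto_id.atTop_mul_const hxpos))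

theorem exists_summable_laplace_pow (hA : B.InstantSubcritical) {z : ℂ} (hz : z ∈ B.laplaceDom) :
    ∃ β : ℝ, 0 ≤ β ∧ z.re ≤ β ∧ (Summable fun n => B.laplace (β : ℂ) ^ n) ∧
      (1 - B.laplace (β : ℂ)).det ≠ 0 := by
  obtain ⟨β, h1, h2, h3⟩ := ((eventually_ge_atTop (0 : ℝ)).and ((eventually_ge_atTop z.re).and
    (eventually_summable_pow hA (B.tendsto_laplace_atTop hz)))).exists
  exact ⟨β, h1, h2, h3⟩

theorem tsum_lap_pow_lt_top {β : ℝ} (hβ : (β : ℂ) ∈ B.laplaceDom)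
    (hsum : Summable fun n => B.laplace (β : ℂ) ^ n) (i j : Fin p) :
    ∑' n : ℕ, (B.lap β ^ n) i j < ⊤ := by
  -- `Lμ(β)` is the complex, and `lap β` the extended form of one matrix with entries in `[0, ∞)`
  let A : Matrix (Fin p) (Fin p) ℝ≥0 := Matrix.of fun i j => (B.lap β i j).toNNReal
  let f : ℝ≥0 →+* ℂ := Complex.ofRealHom.comp NNReal.toRealHom
  have hlap : B.lap β = ENNReal.ofNNRealHom.mapMatrix A := by
    ext i j
    exact (ENNReal.coe_toNNReal (hβ i j).ne).symm
  have hlaplace : B.laplace (β : ℂ) = f.mapMatrix A := by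
    ext i j
    have h1 : B.laplace (β : ℂ) i j =
        ((∫ x : ℝ≥0, Real.exp (-(β * (x : ℝ))) ∂(B.intensity i j) : ℝ) : ℂ) := by
      rw [laplace, Matrix.of_apply, ← integral_complex_ofReal]
      refine integral_congr_ae (Eventually.of_forall fun x => ?_)
      simp
    have h2 : ∫ x : ℝ≥0, Real.exp (-(β * (x : ℝ))) ∂(B.intensity i j) = (B.lap β i j).toReal :=
      integral_eq_lintegral_of_nonneg_ae (Eventually.of_forall fun x => (Real.exp_pos _).le)
        (by fun_prop)
    rw [h1, h2]
    rfl
  have hent : Summable fun n => (B.laplace (β : ℂ) ^ n) i j :=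
    Pi.summable.1 (Pi.summable.1 hsum i) j
  have hA : Summable fun n => (A ^ n) i j := by
    rw [← NNReal.summable_coe]
    refine hent.norm.congr fun n => ?_
    rw [hlaplace, ← map_pow]
    simp [f]
  rw [hlap]
  refine lt_top_iff_ne_top.2 ?_
  convert ENNReal.tsum_coe_ne_top_iff_summable.2 hA using 3 with n
  rw [← map_pow]
  rfl

/-! ### Finiteness of the population in bounded time -/

theorem measurable_lintegral_entry {f : ℝ≥0 → ℝ≥0∞} (hf : Measurable f) (i j : Fin p) :
    Measurable fun M : Fin p → Fin p → Measure ℝ≥0 => ∫⁻ s, f s ∂(M i j) :=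
  (Measure.measurable_lintegral hf).comp ((measurable_pi_apply j).comp (measurable_pi_apply i))

theorem lintegral_lintegral_ξ (u : List ℕ) (i j : Fin p) {f : ℝ≥0 → ℝ≥0∞} (hf : Measurable f) :
    ∫⁻ ω, ∫⁻ s, f s ∂(B.ξ u ω i j) ∂P = ∫⁻ s, f s ∂(B.intensity i j) := by
  rw [intensity, Measure.lintegral_bind (B.measurable_ξ_apply [] i j).aemeasurable hf.aemeasurable]
  exact ((B.identDistrib u).comp (measurable_lintegral_entry hf i j)).lintegral_eq

/-- The weight `e^{-βs}`, extended by `0` to `s = ∞`. -/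
noncomputable def expWeight (β : ℝ) (s : ℝ≥0∞) : ℝ≥0∞ :=
  open Classical in if s = ⊤ then 0 else ENNReal.ofReal (Real.exp (-(β * s.toReal)))

theorem measurable_expWeight (β : ℝ) : Measurable (expWeight β) := by
  unfold expWeight
  exact Measurable.ite (measurableSet_singleton ⊤) measurable_const (by fun_prop)

theorem measurable_expWeight_S (β : ℝ) (u : List ℕ) : Measurable fun ω => expWeight β (B.S u ω) :=
  (measurable_expWeight β).comp (B.measurable_S u)

open Classical in
theorem measurable_moment_integrand (β : ℝ) (u : List ℕ) (j : Fin p) :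
    Measurable fun ω => expWeight β (B.S u ω) * (if B.type u ω = j then 1 else 0) :=
  (B.measurable_expWeight_S β u).mul (Measurable.ite (B.measurable_type u (measurableSet_singleton j))
    measurable_const measurable_const)

open Classical in
/-- `E[e^{-βS(u)}; u is born and of type j]`. -/
noncomputable def moment (β : ℝ) (u : List ℕ) (j : Fin p) : ℝ≥0∞ :=
  ∫⁻ ω, expWeight β (B.S u ω) * (if B.type u ω = j then 1 else 0) ∂P

theorem expWeight_add (β : ℝ) (s x : ℝ≥0∞) :
    expWeight β (s + x) = expWeight β s * expWeight β x := by
  unfold expWeight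
  by_cases hs : s = ⊤
  · simp [hs]
  by_cases hx : x = ⊤
  · simp [hx]
  rw [if_neg hs, if_neg hx, if_neg (ENNReal.add_ne_top.2 ⟨hs, hx⟩), ENNReal.toReal_add hs hx,
    ← ENNReal.ofReal_mul (Real.exp_pos _).le, ← Real.exp_add]
  congr 2
  ring

/-- The many-to-one identity for one generation, which holds because the birth time and the type
of `u` are independent of the offspring of `u`. -/
theorem tsum_moment_children [IsProbabilityMeasure P] (β : ℝ) (u : List ℕ) (j : Fin p) :
    ∑' n : ℕ, B.moment β (n :: u) j = ∑ i, B.moment β u i * B.lap β i j := by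
  classical
  have hexp : Measurable fun s : ℝ≥0 => ENNReal.ofReal (Real.exp (-(β * (s : ℝ)))) := by fun_prop
  have hpath : ∀ ω, ∑' n : ℕ, expWeight β (B.S (n :: u) ω) *
      (if B.type (n :: u) ω = j then 1 else 0) = ∑ i, (expWeight β (B.S u ω) *
        (if B.type u ω = i then 1 else 0)) *
          ∫⁻ s : ℝ≥0, ENNReal.ofReal (Real.exp (-(β * (s : ℝ)))) ∂(B.ξ u ω i j) := fun ω => by
    have h1 := tsum_children_eq_lintegral (B.isPointMeasure u ω (B.type u ω)) (B.type u ω)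
      (f := fun l s => if l = j then ENNReal.ofReal (Real.exp (-(β * (s : ℝ)))) else 0)
      fun l => by split_ifs <;> fun_prop
    have h2 : ∑ l, ∫⁻ s : ℝ≥0, (if l = j then ENNReal.ofReal (Real.exp (-(β * (s : ℝ)))) else 0)
        ∂(B.ξ u ω (B.type u ω) l) =
        ∫⁻ s : ℝ≥0, ENNReal.ofReal (Real.exp (-(β * (s : ℝ)))) ∂(B.ξ u ω (B.type u ω) j) := by
      rw [Finset.sum_eq_single j]
      · simp
      · intro l _ hl
        simp [hl]
      · simp
    rw [h2] at h1
    rw [Finset.sum_eq_single (B.type u ω) (fun i _ hi => by rw [if_neg hi.symm, mul_zero, zero_mul])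
      (by simp), if_pos rfl, mul_one, ← h1, ← ENNReal.tsum_mul_left]
    refine tsum_congr fun n => ?_
    rw [S, expWeight_add, mul_assoc]
    congr 1
    have hX : pointTime (∑ l, B.ξ u ω (B.type u ω) l) n = B.X u n ω := rfl
    rw [hX, expWeight]
    by_cases hn : B.X u n ω = ⊤
    · simp [hn]
    · rw [if_neg hn, if_neg hn]
      simp only [mul_ite, mul_one, mul_zero]
      rfl
  simp only [moment]
  rw [← lintegral_tsum fun n => (B.measurable_moment_integrand β (n :: u) j).aemeasurable]
  simp only [hpath]
  have hm : ∀ i, Measurable fun ω => (expWeight β (B.S u ω) * (if B.type u ω = i then 1 else 0)) *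
      ∫⁻ s : ℝ≥0, ENNReal.ofReal (Real.exp (-(β * (s : ℝ)))) ∂(B.ξ u ω i j) := fun i =>
    (B.measurable_moment_integrand β u i).mul ((Measure.measurable_lintegral hexp).comp
      (B.measurable_ξ_apply u i j))
  rw [lintegral_finsetSum _ fun i _ => hm i]
  refine Finset.sum_congr rfl fun i _ => ?_
  have hlap : B.lap β i j = ∫⁻ ω, ∫⁻ s : ℝ≥0, ENNReal.ofReal (Real.exp (-(β * (s : ℝ))))
      ∂(B.ξ u ω i j) ∂P := (B.lintegral_lintegral_ξ u i j hexp).symm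
  rw [hlap]
  obtain ⟨hT, hS⟩ := B.measurable_type_S_othersSigma u
  have hf : Measurable[B.othersSigma u] fun ω => expWeight β (B.S u ω) *
      (if B.type u ω = i then 1 else 0) :=
    Measurable.mul ((measurable_expWeight β).comp hS)
      (Measurable.ite (hT (measurableSet_singleton i)) measurable_const measurable_const)
  have hg : Measurable[MeasurableSpace.comap (B.ξ u) inferInstance] fun ω =>
      ∫⁻ s : ℝ≥0, ENNReal.ofReal (Real.exp (-(β * (s : ℝ)))) ∂(B.ξ u ω i j) :=
    (measurable_lintegral_entry hexp i j).comp (comap_measurable (B.ξ u))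
  exact lintegral_mul_eq_lintegral_mul_lintegral_of_independent_measurableSpace
    (B.othersSigma_le u) (B.measurable_ξ u).comap_le (B.indep_othersSigma u) hf hg

theorem tsum_list_eq (f : List ℕ → ℝ≥0∞) (h : f [] = 0) :
    ∑' w, f w = ∑' u : List ℕ, ∑' n : ℕ, f (n :: u) := by
  have hinj : Function.Injective fun q : List ℕ × ℕ => q.2 :: q.1 := fun q r hqr => by
    obtain ⟨h1, h2⟩ := List.cons.inj hqr
    exact Prod.ext h2 h1
  rw [← ENNReal.tsum_prod (f := fun u n => f (n :: u))]
  refine (hinj.tsum_eq fun w hw => ?_).symm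
  cases w with
  | nil => exact absurd h hw
  | cons n u => exact ⟨(u, n), rfl⟩

theorem tsum_moment_generation [IsProbabilityMeasure P] (β : ℝ) (N : ℕ) (j : Fin p) :
    ∑' u : List ℕ, (if u.length = N then B.moment β u j else 0) =
      ∑ i, B.moment β [] i * (B.lap β ^ N) i j := by
  induction N generalizing j with
  | zero =>
    rw [tsum_eq_single [] fun u hu => by simp [hu]]
    simp [Matrix.one_apply]
  | succ N ih =>
    rw [tsum_list_eq _ (by simp)]
    have h1 : ∀ u : List ℕ, ∑' n : ℕ, (if (n :: u).length = N + 1 then B.moment β (n :: u) j else 0) =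
        ∑ i, (if u.length = N then B.moment β u i else 0) * B.lap β i j := fun u => by
      simp only [List.length_cons, Nat.add_right_cancel_iff]
      split_ifs
      · exact B.tsum_moment_children β u j
      · simp
    simp only [h1]
    rw [Summable.tsum_finsetSum fun _ _ => ENNReal.summable]
    simp only [ENNReal.tsum_mul_right, ih, Finset.sum_mul, pow_succ, Matrix.mul_apply,
      Finset.mul_sum]
    rw [Finset.sum_comm]
    simp only [mul_assoc]

theorem tsum_moment_lt_top [IsProbabilityMeasure P] {β : ℝ} (hβ : (β : ℂ) ∈ B.laplaceDom)
    (hsum : Summable fun n => B.laplace (β : ℂ) ^ n) (j : Fin p) :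
    ∑' u : List ℕ, B.moment β u j < ⊤ := by
  have h1 : ∑' u : List ℕ, B.moment β u j =
      ∑' N : ℕ, ∑' u : List ℕ, (if u.length = N then B.moment β u j else 0) := by
    rw [ENNReal.tsum_comm]
    refine tsum_congr fun u => ?_
    rw [tsum_eq_single u.length fun N hN => by rw [if_neg (Ne.symm hN)], if_pos rfl]
  rw [h1]
  simp only [tsum_moment_generation]
  rw [Summable.tsum_finsetSum fun _ _ => ENNReal.summable]
  refine ENNReal.sum_lt_top.2 fun i _ => ?_
  rw [ENNReal.tsum_mul_left]
  refine ENNReal.mul_lt_top ?_ (B.tsum_lap_pow_lt_top hβ hsum i j)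
  refine lt_of_le_of_lt (lintegral_mono (g := fun _ => 1) fun ω => ?_) (by simp)
  have h0 : expWeight β (B.S [] ω) = 1 := by
    have hS : B.S [] ω = 0 := rfl
    rw [hS]
    simp [expWeight]
  rw [h0, one_mul]
  split_ifs <;> simp

/-- The expected `β`-discounted number of individuals ever born is finite for large `β`. -/
theorem exists_lintegral_tsum_expWeight_lt_top [IsProbabilityMeasure P] (hA : B.InstantSubcritical)
    {z : ℂ} (hz : z ∈ B.laplaceDom) : ∃ β : ℝ, 0 ≤ β ∧
      ∑' u : List ℕ, ∫⁻ ω, expWeight β (B.S u ω) ∂P < ⊤ := by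
  classical
  obtain ⟨β, h0, hzβ, hsum, -⟩ := B.exists_summable_laplace_pow hA hz
  have hβ : (β : ℂ) ∈ B.laplaceDom := B.mem_laplaceDom_mono hz (by simpa using hzβ)
  refine ⟨β, h0, ?_⟩
  have h1 : ∀ u, ∫⁻ ω, expWeight β (B.S u ω) ∂P = ∑ j, B.moment β u j := fun u => by
    simp only [moment]
    rw [← lintegral_finsetSum _ fun j _ => B.measurable_moment_integrand β u j]
    refine lintegral_congr fun ω => ?_
    simp
  simp only [h1]
  rw [Summable.tsum_finsetSum fun _ _ => ENNReal.summable]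
  exact ENNReal.sum_lt_top.2 fun j _ => B.tsum_moment_lt_top hβ hsum j

theorem indicator_le_expWeight {β : ℝ} (hβ : 0 ≤ β) (t : ℝ≥0) (s : ℝ≥0∞) :
    Set.indicator (Set.Iic (t : ℝ≥0∞)) (fun _ => 1) s ≤
      ENNReal.ofReal (Real.exp (β * t)) * expWeight β s := by
  rw [Set.indicator_apply]
  split_ifs with hs
  · have htop : s ≠ ⊤ := (lt_of_le_of_lt (Set.mem_Iic.1 hs) ENNReal.coe_lt_top).ne
    rw [expWeight, if_neg htop, ← ENNReal.ofReal_mul (Real.exp_pos _).le, ← Real.exp_add,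
      ← ENNReal.ofReal_one]
    refine ENNReal.ofReal_le_ofReal (Real.one_le_exp ?_)
    have h1 : s.toReal ≤ t := by simpa using ENNReal.toReal_mono ENNReal.coe_ne_top hs
    nlinarith
  · exact zero_le

theorem tsum_measure_S_le_lt_top [IsProbabilityMeasure P] (hA : B.InstantSubcritical)
    {z : ℂ} (hz : z ∈ B.laplaceDom) (t : ℝ≥0) :
    ∑' u : List ℕ, P {ω | B.S u ω ≤ t} < ⊤ := by
  obtain ⟨β, h0, hβ⟩ := B.exists_lintegral_tsum_expWeight_lt_top hA hz
  refine lt_of_le_of_lt (ENNReal.tsum_le_tsum fun u => ?_)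
    (lt_of_eq_of_lt ENNReal.tsum_mul_left (ENNReal.mul_lt_top
      (ENNReal.ofReal_lt_top (r := Real.exp (β * t))) hβ))
  rw [← lintegral_const_mul _ (B.measurable_expWeight_S β u),
    ← lintegral_indicator_one (measurableSet_le (B.measurable_S u) measurable_const)]
  exact lintegral_mono fun ω => indicator_le_expWeight h0 t (B.S u ω)

theorem ae_finite_S_le [IsProbabilityMeasure P] (hA : B.InstantSubcritical)
    {z : ℂ} (hz : z ∈ B.laplaceDom) : ∀ᵐ ω ∂P, ∀ t : ℝ≥0, {u | B.S u ω ≤ t}.Finite := by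
  have h1 : ∀ᵐ ω ∂P, ∀ n : ℕ, {u | B.S u ω ≤ ((n : ℝ≥0) : ℝ≥0∞)}.Finite := by
    refine ae_all_iff.2 fun n => ?_
    exact ae_finite_setOfPred_mem (B.tsum_measure_S_le_lt_top hA hz n).ne
  filter_upwards [h1] with ω hω t
  obtain ⟨n, hn⟩ := exists_nat_ge t
  exact (hω n).subset fun u hu => le_trans hu (ENNReal.coe_le_coe.2 hn)

end Branching

/-! ### Laurent coefficients -/

section Laurent

variable {f g : ℂ → ℂ} {c : ℂ}

theorem exists_pos_of_eventually_nhdsNE {p : ℂ → Prop} (h : ∀ᶠ z in 𝓝[≠] c, p z) :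
    ∃ R > 0, ∀ z, z ≠ c → dist z c < R → p z := by
  obtain ⟨R, hR, h⟩ := Metric.mem_nhdsWithin_iff.1 h
  exact ⟨R, hR, fun z hz hzR => h ⟨hzR, hz⟩⟩

theorem eventually_forall_sphere {p : ℂ → Prop} (h : ∀ᶠ z in 𝓝[≠] c, p z) :
    ∀ᶠ r in 𝓝[>] (0 : ℝ), 0 < r ∧ ∀ z ∈ Metric.sphere c r, p z := by
  obtain ⟨R, hR, h⟩ := exists_pos_of_eventually_nhdsNE h
  filter_upwards [Ioo_mem_nhdsGT hR] with r hr
  refine ⟨hr.1, fun z hz => h z ?_ ?_⟩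
  · rintro rfl
    rw [Metric.mem_sphere, dist_self] at hz
    exact hr.1.ne hz
  · rw [Metric.mem_sphere.1 hz]
    exact hr.2

/-- By Cauchy's theorem the circle integrals in the definition of a Laurent coefficient are
independent of the radius once it is small. -/
theorem tendsto_laurentCoeff (hf : MeromorphicAt f c) (n : ℕ) :
    Tendsto (fun r : ℝ => (2 * (Real.pi : ℂ) * Complex.I)⁻¹ * ∮ z in C(c, r), (z - c) ^ n * f z)
      (𝓝[>] (0 : ℝ)) (𝓝 (laurentCoeff f c n)) := by
  refine tendsto_nhds_limUnder ?_
  obtain ⟨R, hR, h⟩ := exists_pos_of_eventually_nhdsNE hf.eventually_analyticAt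
  refine ⟨(2 * (Real.pi : ℂ) * Complex.I)⁻¹ * ∮ z in C(c, R / 2), (z - c) ^ n * f z,
    tendsto_const_nhds.congr' ?_⟩
  filter_upwards [Ioo_mem_nhdsGT (half_pos hR)] with r hr
  congr 1
  have hd : ∀ z, z ≠ c → dist z c < R → DifferentiableAt ℂ (fun z => (z - c) ^ (n + 1) * f z) z :=
    fun z hz hzR => (by fun_prop : DifferentiableAt ℂ (fun z => (z - c) ^ (n + 1)) z).mul
      (h z hz hzR).differentiableAt
  have hne : ∀ z, r ≤ dist z c → z ≠ c := by
    rintro z hz rfl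
    rw [dist_self] at hz
    exact absurd hr.1 (not_lt.2 hz)
  have key := Complex.circleIntegral_sub_center_inv_smul_eq_of_differentiable_on_annulus_off_countable
    hr.1 hr.2.le (f := fun z => (z - c) ^ (n + 1) * f z) Set.countable_empty
    (fun z hz => (hd z (hne z (by simpa using hz.2)) (by
      have := Metric.mem_closedBall.1 hz.1
      linarith)).continuousAt.continuousWithinAt)
    (fun z hz => hd z (hne z (by
      have := hz.1.2
      rw [Metric.mem_closedBall, not_le] at this
      exact this.le)) (by
      have := Metric.mem_ball.1 hz.1.1
      linarith))
  have hcongr : ∀ ρ : ℝ, 0 < ρ → ∮ z in C(c, ρ), (z - c) ^ n * f z =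
      ∮ z in C(c, ρ), (z - c)⁻¹ • ((z - c) ^ (n + 1) * f z) := fun ρ hρ => by
    refine circleIntegral.integral_congr hρ.le fun z hz => ?_
    have hz : z - c ≠ 0 := by
      intro h0
      rw [Metric.mem_sphere, dist_eq_norm, h0, norm_zero] at hz
      exact hρ.ne hz
    simp only [smul_eq_mul]
    rw [pow_succ', ← mul_assoc, inv_mul_cancel_left₀ hz]
  rw [hcongr _ (half_pos hR), hcongr _ hr.1, key]

theorem laurentCoeff_eq_of_tendsto {n : ℕ} {a : ℂ}
    (h : Tendsto (fun r : ℝ => (2 * (Real.pi : ℂ) * Complex.I)⁻¹ * ∮ z in C(c, r), (z - c) ^ n * f z)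
      (𝓝[>] (0 : ℝ)) (𝓝 a)) : laurentCoeff f c n = a :=
  h.limUnder_eq

theorem laurentCoeff_congr (h : f =ᶠ[𝓝[≠] c] g) (hg : MeromorphicAt g c) (n : ℕ) :
    laurentCoeff f c n = laurentCoeff g c n := by
  refine laurentCoeff_eq_of_tendsto ((tendsto_laurentCoeff hg n).congr' ?_)
  filter_upwards [eventually_forall_sphere h] with r hr
  congr 1
  exact circleIntegral.integral_congr hr.1.le fun z hz => by simp only [hr.2 z hz]

theorem eventually_circleIntegrable (hf : MeromorphicAt f c) (n : ℕ) :
    ∀ᶠ r in 𝓝[>] (0 : ℝ), CircleIntegrable (fun z => (z - c) ^ n * f z) c r := by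
  filter_upwards [eventually_forall_sphere hf.eventually_analyticAt] with r hr
  refine ContinuousOn.circleIntegrable hr.1.le fun z hz => ?_
  have h1 : ContinuousAt (fun z => (z - c) ^ n) z := by fun_prop
  exact (h1.mul (hr.2 z hz).continuousAt).continuousWithinAt

theorem laurentCoeff_add (hf : MeromorphicAt f c) (hg : MeromorphicAt g c) (n : ℕ) :
    laurentCoeff (fun z => f z + g z) c n = laurentCoeff f c n + laurentCoeff g c n := by
  refine laurentCoeff_eq_of_tendsto
    (((tendsto_laurentCoeff hf n).add (tendsto_laurentCoeff hg n)).congr' ?_)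
  filter_upwards [eventually_circleIntegrable hf n, eventually_circleIntegrable hg n] with r h1 h2
  rw [← mul_add, ← circleIntegral.integral_add h1 h2]
  simp only [mul_add]

theorem laurentCoeff_const_mul (hf : MeromorphicAt f c) (a : ℂ) (n : ℕ) :
    laurentCoeff (fun z => a * f z) c n = a * laurentCoeff f c n := by
  refine laurentCoeff_eq_of_tendsto (((tendsto_laurentCoeff hf n).const_mul a).congr fun r => ?_)
  simp only [mul_left_comm _ a, circleIntegral.integral_const_mul]

theorem laurentCoeff_pow_mul (m n : ℕ) :
    laurentCoeff (fun z => (z - c) ^ m * f z) c n = laurentCoeff f c (n + m) := by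
  simp only [laurentCoeff, ← mul_assoc, ← pow_add]

theorem laurentCoeff_eq_zero {n : ℕ} (h : (fun z => (z - c) ^ n * f z) =O[𝓝[≠] c] fun _ => (1 : ℝ)) :
    laurentCoeff f c n = 0 := by
  obtain ⟨C, hC⟩ := h.bound
  refine laurentCoeff_eq_of_tendsto ?_
  rw [← mul_zero ((2 * (Real.pi : ℂ) * Complex.I)⁻¹)]
  refine Tendsto.const_mul _ ?_
  have hlim : Tendsto (fun r : ℝ => 2 * Real.pi * r * (C * ‖(1 : ℝ)‖)) (𝓝[>] (0 : ℝ)) (𝓝 0) := by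
    have : Tendsto (fun r : ℝ => 2 * Real.pi * r * (C * ‖(1 : ℝ)‖)) (𝓝 (0 : ℝ))
        (𝓝 (2 * Real.pi * 0 * (C * ‖(1 : ℝ)‖))) := (by fun_prop : Continuous _).tendsto _
    simp only [mul_zero, zero_mul] at this
    exact this.mono_left nhdsWithin_le_nhds
  refine squeeze_zero_norm' ?_ hlim
  filter_upwards [eventually_forall_sphere hC] with r hr
  exact circleIntegral.norm_integral_le_of_norm_le_const hr.1.le hr.2

theorem laurentCoeff_sum {ι : Type*} (s : Finset ι) {f : ι → ℂ → ℂ}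
    (hf : ∀ i ∈ s, MeromorphicAt (f i) c) (n : ℕ) :
    laurentCoeff (fun z => ∑ i ∈ s, f i z) c n = ∑ i ∈ s, laurentCoeff (f i) c n := by
  classical
  induction s using Finset.induction_on with
  | empty =>
    simp only [Finset.sum_empty]
    refine laurentCoeff_eq_zero ?_
    exact (Asymptotics.isBigO_zero (E' := ℂ) (fun _ => (1 : ℝ)) _).congr_left fun z => by simp
  | insert i s hi ih =>
    simp only [Finset.sum_insert hi]
    rw [laurentCoeff_add (hf i (Finset.mem_insert_self _ _))
      (MeromorphicAt.fun_sum fun j hj => hf j (Finset.mem_insert_of_mem hj)),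
      ih fun j hj => hf j (Finset.mem_insert_of_mem hj)]

theorem isBigO_pow_mul_of_poleOrder_le (hf : MeromorphicAt f c) {k : ℕ} (hk : poleOrder f c ≤ k) :
    (fun z => (z - c) ^ k * f z) =O[𝓝[≠] c] fun _ => (1 : ℝ) := by
  by_cases htop : meromorphicOrderAt f c = ⊤
  · have h0 := meromorphicOrderAt_eq_top_iff.1 htop
    refine (Asymptotics.isBigO_zero (fun _ => (1 : ℝ)) (𝓝[≠] c)).congr' ?_ EventuallyEq.rfl
    filter_upwards [h0] with z hz
    rw [hz, mul_zero]
  · obtain ⟨g, hg, -, hfg⟩ := (meromorphicOrderAt_ne_top_iff hf).1 htop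
    set n := (meromorphicOrderAt f c).untop₀ with hn
    have hkn : 0 ≤ (k : ℤ) + n := by
      rw [poleOrder, ← hn] at hk
      omega
    obtain ⟨m, hm⟩ := Int.eq_ofNat_of_zero_le hkn
    have h1 : Tendsto (fun z => (z - c) ^ m * g z) (𝓝[≠] c) (𝓝 ((c - c) ^ m * g c)) :=
      (((by fun_prop : Continuous fun z : ℂ => (z - c) ^ m).tendsto c).mul
        hg.continuousAt).mono_left nhdsWithin_le_nhds
    refine (h1.isBigO_one ℝ).congr' ?_ EventuallyEq.rfl
    filter_upwards [hfg, self_mem_nhdsWithin] with z hz hzc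
    have hz0 : z - c ≠ 0 := sub_ne_zero.2 hzc
    rw [hz, smul_eq_mul, ← mul_assoc, ← zpow_natCast, ← zpow_natCast, ← zpow_add₀ hz0, ← hm]

/-- Laurent coefficients of a solution of `f = f₀ + ∑_j L_j f_j`, where `f₀` and the `L_j` are
holomorphic and the `f_j` have poles of order at most `k`: the Cauchy product of the Taylor
coefficients of the `L_j` and the Laurent coefficients of the `f_j`. -/
theorem laurentCoeff_of_eq_add_sum_mul {ι : Type*} (s : Finset ι) {f f₀ : ℂ → ℂ} {L F : ι → ℂ → ℂ}
    {a : ι → ℕ → ℂ} {k n : ℕ} (hn : n < k)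
    (hf₀ : AnalyticAt ℂ f₀ c) (hL : ∀ j, AnalyticAt ℂ (L j) c) (hF : ∀ j, MeromorphicAt (F j) c)
    (hFk : ∀ j, poleOrder (F j) c ≤ k)
    (hTaylor : ∀ j N, (fun z => L j z - ∑ m ∈ Finset.range N, a j m * (z - c) ^ m) =O[𝓝 c]
      fun z => (z - c) ^ N)
    (heq : f =ᶠ[𝓝[≠] c] fun z => f₀ z + ∑ j ∈ s, L j z * F j z) :
    laurentCoeff f c n = ∑ j ∈ s, ∑ m ∈ Finset.range (k - n), a j m * laurentCoeff (F j) c (n + m) := by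
  have hsub : AnalyticAt ℂ (fun z => z - c) c := analyticAt_id.sub analyticAt_const
  have hpow : ∀ m : ℕ, AnalyticAt ℂ (fun z => (z - c) ^ m) c := fun m => hsub.fun_pow m
  have hterm : ∀ j m, MeromorphicAt (fun z => (z - c) ^ m * F j z) c := fun j m =>
    (hpow m).meromorphicAt.mul (hF j)
  have hterm' : ∀ j m, MeromorphicAt (fun z => a j m * ((z - c) ^ m * F j z)) c := fun j m =>
    (MeromorphicAt.const _ _).mul (hterm j m)
  let rem : ι → ℂ → ℂ := fun j z => L j z - ∑ m ∈ Finset.range (k - n), a j m * (z - c) ^ m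
  have hrem : ∀ j, AnalyticAt ℂ (rem j) c := fun j =>
    (hL j).fun_sub (Finset.analyticAt_fun_sum _ fun m _ => analyticAt_const.fun_mul (hpow m))
  have hremF : ∀ j, MeromorphicAt (fun z => rem j z * F j z) c := fun j =>
    (hrem j).meromorphicAt.mul (hF j)
  have hdecomp : f =ᶠ[𝓝[≠] c] fun z => (f₀ z + ∑ j ∈ s, rem j z * F j z) +
      ∑ j ∈ s, ∑ m ∈ Finset.range (k - n), a j m * ((z - c) ^ m * F j z) := by
    filter_upwards [heq] with z hz
    rw [hz, add_assoc, ← Finset.sum_add_distrib]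
    congr 1
    refine Finset.sum_congr rfl fun j _ => ?_
    simp only [rem, sub_mul, Finset.sum_mul, mul_assoc]
    ring
  have hA : MeromorphicAt (fun z => f₀ z + ∑ j ∈ s, rem j z * F j z) c :=
    hf₀.meromorphicAt.add (MeromorphicAt.fun_sum fun j _ => hremF j)
  have hB : ∀ j, MeromorphicAt (fun z => ∑ m ∈ Finset.range (k - n),
      a j m * ((z - c) ^ m * F j z)) c := fun j => MeromorphicAt.fun_sum fun m _ => hterm' j m
  rw [laurentCoeff_congr hdecomp (hA.add (MeromorphicAt.fun_sum fun j _ => hB j)),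
    laurentCoeff_add hA (MeromorphicAt.fun_sum fun j _ => hB j),
    laurentCoeff_sum s (fun j _ => hB j)]
  -- `(z - c) ^ n` times the remainder of order `k - n` cancels the poles of the `F j`
  have hzero : laurentCoeff (fun z => f₀ z + ∑ j ∈ s, rem j z * F j z) c n = 0 := by
    rw [laurentCoeff_add hf₀.meromorphicAt (MeromorphicAt.fun_sum fun j _ => hremF j),
      laurentCoeff_sum s (fun j _ => hremF j), laurentCoeff_eq_zero, zero_add]
    · refine Finset.sum_eq_zero fun j _ => laurentCoeff_eq_zero ?_
      have h1 : (fun z => (z - c) ^ n * rem j z) =O[𝓝[≠] c] fun z => (z - c) ^ k := by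
        have h2 := (Asymptotics.isBigO_refl (fun z => (z - c) ^ n) (𝓝[≠] c)).mul
          ((hTaylor j (k - n)).mono nhdsWithin_le_nhds)
        refine h2.congr_right fun z => ?_
        rw [← pow_add, Nat.add_sub_cancel' hn.le]
      have h3 := h1.mul (Asymptotics.isBigO_refl (F j) (𝓝[≠] c))
      refine (h3.trans (isBigO_pow_mul_of_poleOrder_le (hF j) (hFk j))).congr_left fun z => ?_
      ring
    · have h1 : Tendsto (fun z => (z - c) ^ n * f₀ z) (𝓝[≠] c) (𝓝 ((c - c) ^ n * f₀ c)) :=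
        ((hpow n).continuousAt.mul hf₀.continuousAt).tendsto.mono_left nhdsWithin_le_nhds
      exact h1.isBigO_one ℝ
  rw [hzero, zero_add]
  refine Finset.sum_congr rfl fun j _ => ?_
  rw [laurentCoeff_sum _ fun m _ => hterm' j m]
  refine Finset.sum_congr rfl fun m _ => ?_
  rw [laurentCoeff_const_mul (hterm j m), laurentCoeff_pow_mul]

end Laurent

namespace Branching

/-! ### The resolvent and the eigenvector equation -/

variable {Ω : Type*} [mΩ : MeasurableSpace Ω] {p : ℕ} {P : Measure Ω} (B : Branching p P)

theorem laplace_apply_eq_complexMGF (z : ℂ) (i j : Fin p) :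
    B.laplace z i j = complexMGF (fun x : ℝ≥0 => (x : ℝ)) (B.intensity i j) (-z) := by
  simp only [laplace, Matrix.of_apply, complexMGF, neg_mul]

variable {B} in
theorem neg_re_mem_interior_integrableExpSet {z : ℂ} (hz : z ∈ interior B.laplaceDom) (i j : Fin p) :
    (-z).re ∈ interior (integrableExpSet (fun x : ℝ≥0 => (x : ℝ)) (B.intensity i j)) := by
  obtain ⟨ε, hε, hball⟩ := Metric.mem_nhds_iff.1 (mem_interior_iff_mem_nhds.1 hz)
  rw [mem_interior_iff_mem_nhds]
  refine Metric.mem_nhds_iff.2 ⟨ε, hε, fun t ht => ?_⟩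
  have hmem : ((-t : ℝ) : ℂ) + (z.im : ℂ) * Complex.I ∈ B.laplaceDom := by
    refine hball ?_
    rw [Metric.mem_ball, dist_eq_norm]
    have : ((-t : ℝ) : ℂ) + (z.im : ℂ) * Complex.I - z = ((-t - z.re : ℝ) : ℂ) := by
      apply Complex.ext <;> simp
    rw [this, Complex.norm_real, ← norm_neg]
    rw [Metric.mem_ball, dist_eq_norm, Complex.neg_re] at ht
    rwa [show -(-t - z.re) = t - -z.re by ring]
  have hint := B.integrable_exp_of_mem_laplaceDom hmem i j
  simpa [integrableExpSet] using hint

variable {B} in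
theorem analyticAt_laplace {z : ℂ} (hz : z ∈ interior B.laplaceDom) (i j : Fin p) :
    AnalyticAt ℂ (fun z => B.laplace z i j) z := by
  simp only [laplace_apply_eq_complexMGF]
  exact (analyticAt_complexMGF (neg_re_mem_interior_integrableExpSet hz i j)).fun_comp
    analyticAt_id.neg

/-- The Taylor coefficients `∫ e^{-λx} (-x)^m / m! μ^{i,j}(dx)` of the Laplace transform. -/
noncomputable def taylorCoeff (lam : ℂ) (i j : Fin p) (m : ℕ) : ℂ :=
  ∫ x : ℝ≥0, Complex.exp (lam * ((-(x : ℝ) : ℝ) : ℂ)) *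
    (((-(x : ℝ) : ℝ) : ℂ) ^ m / (m.factorial : ℂ)) ∂(B.intensity i j)

variable {B} in
theorem laplace_sub_taylor_isBigO {lam : ℂ} (hlam : lam ∈ interior B.laplaceDom) (i j : Fin p)
    (N : ℕ) : (fun z => B.laplace z i j - ∑ m ∈ Finset.range N,
      B.taylorCoeff lam i j m * (z - lam) ^ m) =O[𝓝 lam] fun z => (z - lam) ^ N := by
  have hre := neg_re_mem_interior_integrableExpSet hlam i j
  have h1 := (analyticAt_complexMGF hre).hasFPowerSeriesAt.isBigO_sub_partialSum_pow N
  have hlim : Tendsto (fun z : ℂ => lam - z) (𝓝 lam) (𝓝 0) := by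
    have : Tendsto (fun z : ℂ => lam - z) (𝓝 lam) (𝓝 (lam - lam)) :=
      (by fun_prop : Continuous fun z : ℂ => lam - z).tendsto lam
    rwa [sub_self] at this
  have h2 := h1.comp_tendsto hlim
  refine (h2.congr_left fun z => ?_).trans (Asymptotics.IsBigO.of_norm_right ?_)
  · simp only [Function.comp_apply, laplace_apply_eq_complexMGF]
    congr 1
    · congr 1
      ring
    · rw [FormalMultilinearSeries.partialSum]
      refine Finset.sum_congr rfl fun m _ => ?_
      rw [FormalMultilinearSeries.ofScalars_apply_eq, iteratedDeriv_complexMGF hre, smul_eq_mul,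
        taylorCoeff, div_mul_eq_mul_div, mul_div_assoc, ← integral_mul_const, ← integral_mul_const]
      refine integral_congr_ae (Eventually.of_forall fun x => ?_)
      have h3 : lam - z = -(z - lam) := by ring
      simp only [Complex.ofReal_neg]
      rw [h3, neg_pow (z - lam), neg_pow ((x : ℝ) : ℂ), show -lam * ((x : ℝ) : ℂ) = lam * -((x : ℝ) : ℂ) by ring]
      ring
  · refine Asymptotics.IsBigO.of_bound 1 (Eventually.of_forall fun z => ?_)
    simp [norm_sub_rev]

variable {B} in
theorem analyticAt_det {M : ℂ → Matrix (Fin p) (Fin p) ℂ} {z : ℂ}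
    (hM : ∀ i j, AnalyticAt ℂ (fun z => M z i j) z) : AnalyticAt ℂ (fun z => (M z).det) z := by
  simp only [Matrix.det_apply']
  exact Finset.analyticAt_fun_sum _ fun σ _ =>
    analyticAt_const.fun_mul (Finset.analyticAt_fun_prod _ fun i _ => hM _ _)

variable {B} in
theorem analyticAt_one_sub_laplace {z : ℂ} (hz : z ∈ interior B.laplaceDom) (i j : Fin p) :
    AnalyticAt ℂ (fun z => (1 - B.laplace z) i j) z := by
  simp only [Matrix.sub_apply]
  exact analyticAt_const.fun_sub (analyticAt_laplace hz i j)

variable {B} in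
theorem meromorphicAt_resolvent {z : ℂ} (hz : z ∈ interior B.laplaceDom) (i j : Fin p) :
    MeromorphicAt (fun z => B.resolvent z i j) z := by
  simp only [resolvent, Matrix.inv_def, Ring.inverse_eq_inv', Matrix.smul_apply, smul_eq_mul,
    Matrix.adjugate_apply]
  refine (analyticAt_det (analyticAt_one_sub_laplace hz)).meromorphicAt.fun_inv.fun_mul
    (AnalyticAt.meromorphicAt (analyticAt_det fun a b => ?_))
  simp only [Matrix.updateRow_apply]
  split_ifs
  · exact analyticAt_const
  · exact analyticAt_one_sub_laplace hz a b

variable {B} in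
/-- The determinant of `I - Lμ` does not vanish identically: for large real arguments the Neumann
series of `Lμ` converges, and the half-plane of convergence is connected. -/
theorem eventually_det_one_sub_laplace_ne_zero (hA : B.InstantSubcritical) {lam : ℂ}
    (hlam : lam ∈ interior B.laplaceDom) :
    ∀ᶠ z in 𝓝[≠] lam, (1 - B.laplace z).det ≠ 0 := by
  refine ((analyticAt_det (analyticAt_one_sub_laplace hlam)).eventually_eq_zero_or_eventually_ne_zero
    ).resolve_left fun h0 => ?_
  obtain ⟨ε, hε, hball⟩ := Metric.mem_nhds_iff.1 (mem_interior_iff_mem_nhds.1 hlam)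
  have hθ : lam - ((ε / 2 : ℝ) : ℂ) ∈ B.laplaceDom := hball (by
    rw [Metric.mem_ball, dist_eq_norm, sub_sub_cancel_left, norm_neg, Complex.norm_real,
      Real.norm_of_nonneg (by positivity)]
    linarith)
  set θ := lam.re - ε / 2 with hθdef
  have hθre : (lam - ((ε / 2 : ℝ) : ℂ)).re = θ := by simp [hθdef]
  have hU : {z : ℂ | θ < z.re} ⊆ interior B.laplaceDom := by
    refine interior_maximal (fun z hz => B.mem_laplaceDom_mono hθ ?_)
      (isOpen_lt continuous_const Complex.continuous_re)
    rw [hθre]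
    exact le_of_lt hz
  obtain ⟨β, -, hβ, -, hdet⟩ := B.exists_summable_laplace_pow hA (interior_subset hlam)
  have hzero := AnalyticOnNhd.eqOn_zero_of_preconnected_of_eventuallyEq_zero
    (f := fun z => (1 - B.laplace z).det) (U := {z : ℂ | θ < z.re})
    (fun z hz => analyticAt_det (analyticAt_one_sub_laplace (hU hz)))
    (convex_halfSpace_re_gt θ).isPreconnected
    (z₀ := lam) (show θ < lam.re by rw [hθdef]; linarith) h0
  refine hdet (hzero (x := (β : ℂ)) ?_)
  change θ < (β : ℂ).re
  rw [Complex.ofReal_re, hθdef]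
  linarith

variable {B} in
theorem resolvent_eq {z : ℂ} (h : (1 - B.laplace z).det ≠ 0) :
    B.resolvent z = 1 + B.laplace z * B.resolvent z := by
  have h1 : (1 - B.laplace z) * B.resolvent z = 1 :=
    Matrix.mul_nonsing_inv _ (isUnit_iff_ne_zero.2 h)
  rw [Matrix.sub_mul, Matrix.one_mul, sub_eq_iff_eq_add] at h1
  exact h1

theorem poleOrder_le_kOrd (lam : ℂ) (i j : Fin p) :
    poleOrder (fun z => B.resolvent z i j) lam ≤ B.kOrd lam := by
  have h := Finset.le_sup (α := ℕ) (f := fun ij : Fin p × Fin p =>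
    poleOrder (fun z => B.resolvent z ij.1 ij.2) lam) (Finset.mem_univ (i, j))
  unfold kOrd
  exact h

variable {B} in
theorem integrable_expMat_intensity {lam : ℂ} (hlam : lam ∈ interior B.laplaceDom) {k : ℕ}
    (i j : Fin p) (a b : Fin k) :
    Integrable (fun s : ℝ≥0 => expMat k lam (-(s : ℝ)) a b) (B.intensity i j) := by
  simp only [expMat_apply]
  split_ifs
  · have h1 := integrable_pow_abs_mul_exp_of_mem_interior_integrableExpSet
      (neg_re_mem_interior_integrableExpSet hlam i j) ((b : ℕ) - (a : ℕ))
    refine (h1.div_const (((b : ℕ) - (a : ℕ)).factorial : ℝ)).mono' (by fun_prop)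
      (Eventually.of_forall fun s => le_of_eq ?_)
    rw [norm_mul, norm_div, norm_pow, Complex.norm_real, Complex.norm_natCast, Complex.norm_exp,
      norm_neg, Real.norm_eq_abs]
    have : (lam * ((-(s : ℝ) : ℝ) : ℂ)).re = (-lam).re * (s : ℝ) := by simp
    rw [this]
    ring
  · exact integrable_zero _ _ _

variable {B} in
/-- The eigenvector equation `(∫ exp(λ, -s) ⊗ μ(ds)) A_λ = A_λ`. It expresses that the principal
parts at `λ` of the resolvent `R` and of `Lμ R = R - I` are the same. -/
theorem kronIntegral_intensity_mul_vecA (hA : B.InstantSubcritical) {lam : ℂ}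
    (hlam : lam ∈ interior B.laplaceDom) :
    kronIntegral (fun s : ℝ≥0 => expMat (B.kOrd lam) lam (-(s : ℝ))) B.intensity * B.vecA lam =
      B.vecA lam := by
  ext ⟨a, i⟩ q
  have heq : (fun z => B.resolvent z i q) =ᶠ[𝓝[≠] lam] fun z =>
      (1 : Matrix (Fin p) (Fin p) ℂ) i q + ∑ j, B.laplace z i j * B.resolvent z j q := by
    filter_upwards [eventually_det_one_sub_laplace_ne_zero hA hlam] with z hz
    conv_lhs => rw [resolvent_eq hz]
    rw [Matrix.add_apply, Matrix.mul_apply]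
  have key := laurentCoeff_of_eq_add_sum_mul Finset.univ a.2
    (analyticAt_const (v := (1 : Matrix (Fin p) (Fin p) ℂ) i q))
    (fun j => analyticAt_laplace hlam i j) (fun j => meromorphicAt_resolvent hlam j q)
    (fun j => B.poleOrder_le_kOrd lam j q)
    (fun j N => laplace_sub_taylor_isBigO hlam i j N) heq
  have hv : ∀ (b : Fin (B.kOrd lam)) (l : Fin p), B.vecA lam (b, l) q =
      laurentCoeff (fun z => B.resolvent z l q) lam b := fun _ _ => rfl
  rw [hv, key, Matrix.mul_apply, Fintype.sum_prod_type, Finset.sum_comm]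
  refine Finset.sum_congr rfl fun j _ => ?_
  simp only [hv]
  have hK : ∀ b : Fin (B.kOrd lam), kronIntegral (fun s : ℝ≥0 => expMat (B.kOrd lam) lam (-(s : ℝ)))
      B.intensity (a, i) (b, j) = if (a : ℕ) ≤ b then B.taylorCoeff lam i j (b - a) else 0 := fun b => by
    have hab : a ≤ b ↔ (a : ℕ) ≤ b := Iff.rfl
    simp only [kronIntegral, Matrix.of_apply, expMat_apply, hab, taylorCoeff]
    split_ifs
    · rfl
    · simp
  simp only [hK]
  rw [Fin.sum_univ_eq_sum_range (fun b : ℕ => (if (a : ℕ) ≤ b then B.taylorCoeff lam i j (b - a)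
    else 0) * laurentCoeff (fun z => B.resolvent z j q) lam b) (B.kOrd lam),
    ← Finset.sum_range_add_sum_Ico _ a.2.le, Finset.sum_eq_zero, zero_add, Finset.sum_Ico_eq_sum_range]
  · refine Finset.sum_congr rfl fun m _ => ?_
    rw [if_pos (Nat.le_add_right _ _), Nat.add_sub_cancel_left]
  · intro b hb
    rw [if_neg (not_le.2 (Finset.mem_range.1 hb)), zero_mul]

end Branching

namespace Branching

/-! ### Expectations of sums over the offspring of an individual -/

variable {Ω : Type*} [mΩ : MeasurableSpace Ω] {p : ℕ} {P : Measure Ω} (B : Branching p P)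

theorem ae_integrable_ξ (u : List ℕ) (i j : Fin p) {f : ℝ≥0 → ℂ} (hm : Measurable f)
    (hf : Integrable f (B.intensity i j)) : ∀ᵐ ω ∂P, Integrable f (B.ξ u ω i j) := by
  have h1 : ∫⁻ ω, ∫⁻ s, ‖f s‖ₑ ∂(B.ξ u ω i j) ∂P ≠ ⊤ := by
    rw [B.lintegral_lintegral_ξ u i j hm.enorm]
    exact hf.hasFiniteIntegral.ne
  filter_upwards [ae_lt_top ((measurable_lintegral_entry hm.enorm i j).comp (B.measurable_ξ u)) h1]
    with ω hω
  exact ⟨hm.aestronglyMeasurable, hω⟩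

theorem bind_ξ_eq_intensity (u : List ℕ) (i j : Fin p) :
    P.bind (fun ω => B.ξ u ω i j) = B.intensity i j := by
  ext s hs
  rw [← lintegral_indicator_one hs, ← lintegral_indicator_one hs,
    Measure.lintegral_bind (B.measurable_ξ_apply u i j).aemeasurable
      (measurable_one.indicator hs).aemeasurable,
    B.lintegral_lintegral_ξ u i j (measurable_one.indicator hs)]

theorem integral_integral_ξ (u : List ℕ) (i j : Fin p) {f : ℝ≥0 → ℂ}
    (hf : Integrable f (B.intensity i j)) :
    ∫ ω, ∫ s, f s ∂(B.ξ u ω i j) ∂P = ∫ s, f s ∂(B.intensity i j) := by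
  let κ : Kernel Ω ℝ≥0 := ⟨fun ω => B.ξ u ω i j, B.measurable_ξ_apply u i j⟩
  have h1 : (κ ∘ₖ Kernel.const Unit P) () = B.intensity i j := by
    rw [← Measure.comp_eq_comp_const_apply]
    exact B.bind_ξ_eq_intensity u i j
  rw [← h1, Kernel.integral_comp (by rwa [h1])]
  rfl

theorem measurable_integral_ξ (u : List ℕ) (i j : Fin p) {f : ℝ≥0 → ℂ} (hm : Measurable f) :
    Measurable[MeasurableSpace.comap (B.ξ u) inferInstance] fun ω => ∫ s, f s ∂(B.ξ u ω i j) :=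
  measurable_integral_of_isPointMeasure
    (((measurable_pi_apply j).comp (measurable_pi_apply i)).comp (comap_measurable (B.ξ u)))
    (fun ω => B.isPointMeasure u ω i j) (hm.comp measurable_snd)

theorem lintegral_enorm_integral_ξ_le (u : List ℕ) (i j : Fin p) {f : ℝ≥0 → ℂ} (hm : Measurable f) :
    ∫⁻ ω, ‖∫ s, f s ∂(B.ξ u ω i j)‖ₑ ∂P ≤ ∫⁻ s, ‖f s‖ₑ ∂(B.intensity i j) := by
  rw [← B.lintegral_lintegral_ξ u i j hm.enorm]
  exact lintegral_mono fun ω => enorm_integral_le_lintegral_enorm _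

variable {B}

theorem measurable_expMat_neg {k : ℕ} (lam : ℂ) (a b : Fin k) :
    Measurable fun s : ℝ≥0 => expMat k lam (-(s : ℝ)) a b :=
  (continuous_expMat lam a b).measurable.comp measurable_coe_nnreal_real.neg

theorem ae_isRegular [IsProbabilityMeasure P] (hA : B.InstantSubcritical) {lam : ℂ}
    (hlam : lam ∈ interior B.laplaceDom) : ∀ᵐ ω ∂P, B.IsRegular lam ω := by
  have h1 : ∀ᵐ ω ∂P, ∀ u i j a b,
      Integrable (fun s : ℝ≥0 => expMat (B.kOrd lam) lam (-(s : ℝ)) a b) (B.ξ u ω i j) := by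
    simp only [ae_all_iff]
    exact fun u i j a b => B.ae_integrable_ξ u i j (measurable_expMat_neg lam a b)
      (integrable_expMat_intensity hlam i j a b)
  filter_upwards [h1, B.ae_finite_S_le hA (interior_subset hlam)] with ω h1 h2
  exact ⟨h1, h2⟩

/-! ### The increments have mean zero -/

variable (B) in
/-- The entries of `(∫ exp(λ, -s) ⊗ ξ_u(ds) - I) A_λ`. -/
noncomputable def excess (lam : ℂ) (u : List ℕ) (b : Fin (B.kOrd lam)) (i q : Fin p) (ω : Ω) : ℂ :=
  ∑ y : Fin (B.kOrd lam) × Fin p,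
    (∫ s : ℝ≥0, expMat (B.kOrd lam) lam (-(s : ℝ)) b y.1 ∂(B.ξ u ω i y.2)) * B.vecA lam y q -
      B.vecA lam (b, i) q

variable {lam : ℂ} {u : List ℕ}

theorem increment_apply (ω : Ω) (a : Fin (B.kOrd lam)) (q : Fin p) :
    B.increment lam u ω a q = ∑ b, expMat (B.kOrd lam) lam (-(B.S u ω).toReal) a b *
      B.excess lam u b (B.type u ω) q ω := by
  rw [increment, Matrix.mul_apply]
  refine Finset.sum_congr rfl fun b _ => ?_
  rw [kronRow_one_mul_apply, Matrix.sub_apply, Matrix.mul_apply]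
  rfl

theorem measurable_excess (b : Fin (B.kOrd lam)) (i q : Fin p) :
    Measurable[MeasurableSpace.comap (B.ξ u) inferInstance] (B.excess lam u b i q) := by
  refine Measurable.sub (Finset.measurable_sum _ fun y _ => Measurable.mul_const ?_ _)
    measurable_const
  exact B.measurable_integral_ξ u i y.2 (measurable_expMat_neg lam b y.1)

theorem exists_lintegral_enorm_excess_le [IsProbabilityMeasure P]
    (hlam : lam ∈ interior B.laplaceDom) (b : Fin (B.kOrd lam)) (i q : Fin p) :
    ∃ C < ⊤, ∀ u, ∫⁻ ω, ‖B.excess lam u b i q ω‖ₑ ∂P ≤ C := by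
  refine ⟨∑ y : Fin (B.kOrd lam) × Fin p,
    (∫⁻ s : ℝ≥0, ‖expMat (B.kOrd lam) lam (-(s : ℝ)) b y.1‖ₑ ∂(B.intensity i y.2)) *
      ‖B.vecA lam y q‖ₑ + ‖B.vecA lam (b, i) q‖ₑ, ?_, fun u => ?_⟩
  · refine ENNReal.add_lt_top.2 ⟨ENNReal.sum_lt_top.2 fun y _ => ENNReal.mul_lt_top ?_ enorm_lt_top,
      enorm_lt_top⟩
    exact (integrable_expMat_intensity hlam i y.2 b y.1).hasFiniteIntegral
  · have hmeas : ∀ y : Fin (B.kOrd lam) × Fin p, Measurable fun ω =>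
        ∫ s : ℝ≥0, expMat (B.kOrd lam) lam (-(s : ℝ)) b y.1 ∂(B.ξ u ω i y.2) := fun y =>
      (B.measurable_integral_ξ u i y.2 (measurable_expMat_neg lam b y.1)).mono
        (B.measurable_ξ u).comap_le le_rfl
    calc ∫⁻ ω, ‖B.excess lam u b i q ω‖ₑ ∂P
        ≤ ∫⁻ ω, (∑ y : Fin (B.kOrd lam) × Fin p,
            ‖∫ s : ℝ≥0, expMat (B.kOrd lam) lam (-(s : ℝ)) b y.1 ∂(B.ξ u ω i y.2)‖ₑ *
              ‖B.vecA lam y q‖ₑ + ‖B.vecA lam (b, i) q‖ₑ) ∂P := by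
          refine lintegral_mono fun ω => (enorm_sub_le).trans (add_le_add_left ?_ _)
          refine (enorm_sum_le _ _).trans (le_of_eq ?_)
          simp only [enorm_mul]
      _ = ∑ y : Fin (B.kOrd lam) × Fin p,
            (∫⁻ ω, ‖∫ s : ℝ≥0, expMat (B.kOrd lam) lam (-(s : ℝ)) b y.1 ∂(B.ξ u ω i y.2)‖ₑ ∂P) *
              ‖B.vecA lam y q‖ₑ + ‖B.vecA lam (b, i) q‖ₑ := by
          rw [lintegral_add_right _ measurable_const,
            lintegral_finsetSum _ fun y _ => (hmeas y).enorm.mul_const _]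
          simp only [lintegral_mul_const _ (hmeas _).enorm]
          simp
      _ ≤ _ := by
          refine add_le_add_left (Finset.sum_le_sum fun y _ => ?_) _
          gcongr
          exact B.lintegral_enorm_integral_ξ_le u i y.2 (measurable_expMat_neg lam b y.1)

theorem integrable_excess [IsProbabilityMeasure P] (hlam : lam ∈ interior B.laplaceDom)
    (b : Fin (B.kOrd lam)) (i q : Fin p) : Integrable (B.excess lam u b i q) P := by
  obtain ⟨C, hC, h⟩ := exists_lintegral_enorm_excess_le hlam b i q
  exact ⟨((measurable_excess b i q).mono (B.measurable_ξ u).comap_le le_rfl).aestronglyMeasurable,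
    (h u).trans_lt hC⟩

theorem integral_excess [IsProbabilityMeasure P] (hA : B.InstantSubcritical)
    (hlam : lam ∈ interior B.laplaceDom) (b : Fin (B.kOrd lam)) (i q : Fin p) :
    ∫ ω, B.excess lam u b i q ω ∂P = 0 := by
  have hint : ∀ y : Fin (B.kOrd lam) × Fin p, Integrable (fun ω =>
      ∫ s : ℝ≥0, expMat (B.kOrd lam) lam (-(s : ℝ)) b y.1 ∂(B.ξ u ω i y.2)) P := fun y =>
    ⟨((B.measurable_integral_ξ u i y.2 (measurable_expMat_neg lam b y.1)).mono
      (B.measurable_ξ u).comap_le le_rfl).aestronglyMeasurable,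
      (B.lintegral_enorm_integral_ξ_le u i y.2 (measurable_expMat_neg lam b y.1)).trans_lt
        (integrable_expMat_intensity hlam i y.2 b y.1).hasFiniteIntegral⟩
  simp only [excess]
  rw [integral_sub (integrable_finsetSum _ fun y _ => (hint y).mul_const _) (integrable_const _),
    integral_finsetSum _ fun y _ => (hint y).mul_const _]
  simp only [integral_mul_const]
  have h := congrFun (congrFun (kronIntegral_intensity_mul_vecA hA hlam) (b, i)) q
  rw [Matrix.mul_apply] at h
  rw [integral_const, probReal_univ, one_smul, sub_eq_zero, ← h]
  refine Finset.sum_congr rfl fun y _ => ?_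
  rw [B.integral_integral_ξ u i y.2 (integrable_expMat_intensity hlam i y.2 b y.1)]
  rfl

open Classical in
variable (B) in
/-- The weight with which `excess` enters the increment of an individual `u` of type `i` that is
born by time `t`. It depends on the individuals other than `u` only, whereas `excess` depends on the
offspring of `u` only. -/
noncomputable def weight (lam : ℂ) (t : ℝ≥0) (u : List ℕ) (a b : Fin (B.kOrd lam)) (i : Fin p)
    (ω : Ω) : ℂ :=
  if B.S u ω ≤ t ∧ B.type u ω = i then expMat (B.kOrd lam) lam (-(B.S u ω).toReal) a b else 0

theorem measurable_weight (t : ℝ≥0) (a b : Fin (B.kOrd lam)) (i : Fin p) :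
    Measurable[B.othersSigma u] (B.weight lam t u a b i) := by
  obtain ⟨hT, hS⟩ := B.measurable_type_S_othersSigma u
  exact Measurable.ite ((hS measurableSet_Iic).inter (hT (measurableSet_singleton i)))
    ((continuous_expMat lam a b).measurable.comp hS.ennreal_toReal.neg) measurable_const

theorem exists_enorm_weight_le (t : ℝ≥0) (a b : Fin (B.kOrd lam)) (i : Fin p) :
    ∃ C : ℝ≥0, ∀ u ω, ‖B.weight lam t u a b i ω‖ₑ ≤
      C * {ω | B.S u ω ≤ t}.indicator (fun _ => 1) ω := by
  obtain ⟨C, hC⟩ := (isCompact_Icc (a := (0 : ℝ)) (b := t)).exists_bound_of_continuousOn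
    (f := fun x => expMat (B.kOrd lam) lam (-x) a b)
    ((continuous_expMat lam a b).comp continuous_neg).continuousOn
  refine ⟨C.toNNReal, fun u ω => ?_⟩
  rw [weight]
  by_cases hS : B.S u ω ≤ t
  · by_cases hi : B.type u ω = i
    · rw [if_pos ⟨hS, hi⟩, Set.indicator_of_mem (show ω ∈ {ω | B.S u ω ≤ t} from hS), mul_one, ← ofReal_norm]
      refine ENNReal.ofReal_le_ofReal (hC _ ⟨ENNReal.toReal_nonneg, ?_⟩)
      simpa using ENNReal.toReal_mono ENNReal.coe_ne_top hS
    · rw [if_neg fun h => hi h.2, enorm_zero]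
      exact zero_le
  · rw [if_neg fun h => hS h.1, enorm_zero]
    exact zero_le

open Classical in
variable (B) in
/-- An entry of the increment of `u`, provided that `u` is born by time `t`. -/
noncomputable def incr (lam : ℂ) (t : ℝ≥0) (u : List ℕ) (a : Fin (B.kOrd lam)) (q : Fin p)
    (ω : Ω) : ℂ :=
  if B.S u ω ≤ t then B.increment lam u ω a q else 0

theorem incr_eq_sum (t : ℝ≥0) (a : Fin (B.kOrd lam)) (q : Fin p) (ω : Ω) :
    B.incr lam t u a q ω = ∑ i, ∑ b, B.weight lam t u a b i ω * B.excess lam u b i q ω := by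
  rw [incr, increment_apply]
  simp only [weight]
  split_ifs with hS
  · rw [Finset.sum_eq_single (B.type u ω)]
    · simp [hS]
    · intro i _ hi
      simp [hi.symm]
    · simp
  · simp [hS]

theorem integrable_weight [IsProbabilityMeasure P] (t : ℝ≥0) (a b : Fin (B.kOrd lam)) (i : Fin p) :
    Integrable (B.weight lam t u a b i) P := by
  obtain ⟨C, hC⟩ := exists_enorm_weight_le (B := B) (lam := lam) t a b i
  refine ⟨((measurable_weight t a b i).mono (B.othersSigma_le u) le_rfl).aestronglyMeasurable,
    lt_of_le_of_lt (lintegral_mono (g := fun _ => (C : ℝ≥0∞)) fun ω => (hC u ω).trans ?_) (by simp)⟩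
  refine mul_le_of_le_one_right zero_le ?_
  exact Set.indicator_le_self' (by simp) ω

theorem indepFun_of_measurable [IsProbabilityMeasure P] {X Y : Ω → ℂ}
    (hX : Measurable[B.othersSigma u] X)
    (hY : Measurable[MeasurableSpace.comap (B.ξ u) inferInstance] Y) : X ⟂ᵢ[P] Y := by
  rw [IndepFun_iff_Indep]
  exact indep_of_indep_of_le_left (indep_of_indep_of_le_right (B.indep_othersSigma u) hY.comap_le)
    hX.comap_le

theorem integrable_weight_mul_excess [IsProbabilityMeasure P] (hlam : lam ∈ interior B.laplaceDom)
    (t : ℝ≥0) (a b : Fin (B.kOrd lam)) (i q : Fin p) :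
    Integrable (fun ω => B.weight lam t u a b i ω * B.excess lam u b i q ω) P :=
  (indepFun_of_measurable (measurable_weight t a b i) (measurable_excess b i q)).integrable_mul
    (integrable_weight t a b i) (integrable_excess hlam b i q)

theorem integrable_incr [IsProbabilityMeasure P] (hlam : lam ∈ interior B.laplaceDom)
    (t : ℝ≥0) (u : List ℕ) (a : Fin (B.kOrd lam)) (q : Fin p) :
    Integrable (B.incr lam t u a q) P := by
  have h : B.incr lam t u a q = fun ω =>
      ∑ i, ∑ b, B.weight lam t u a b i ω * B.excess lam u b i q ω :=
    funext fun ω => incr_eq_sum t a q ω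
  rw [h]
  exact integrable_finsetSum _ fun i _ => integrable_finsetSum _ fun b _ =>
    integrable_weight_mul_excess hlam t a b i q

/-- The increment of `u` has mean zero on every event that does not depend on the offspring
of `u`. -/
theorem setIntegral_incr_eq_zero [IsProbabilityMeasure P] (hA : B.InstantSubcritical)
    (hlam : lam ∈ interior B.laplaceDom) (t : ℝ≥0) (a : Fin (B.kOrd lam)) (q : Fin p) {G : Set Ω}
    (hG : MeasurableSet[B.othersSigma u] G) : ∫ ω in G, B.incr lam t u a q ω ∂P = 0 := by
  have hGm : MeasurableSet G := B.othersSigma_le u _ hG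
  simp only [incr_eq_sum]
  rw [integral_finsetSum _ fun i _ => (integrable_finsetSum _ fun b _ =>
    integrable_weight_mul_excess hlam t a b i q).integrableOn]
  refine Finset.sum_eq_zero fun i _ => ?_
  rw [integral_finsetSum _ fun b _ => (integrable_weight_mul_excess hlam t a b i q).integrableOn]
  refine Finset.sum_eq_zero fun b _ => ?_
  have hX : Measurable[B.othersSigma u] (G.indicator (B.weight lam t u a b i)) :=
    (measurable_weight t a b i).indicator hG
  have hY := measurable_excess (B := B) (lam := lam) (u := u) b i q
  rw [← integral_indicator hGm]
  have h := (indepFun_of_measurable hX hY).integral_fun_mul_eq_mul_integral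
    (hX.mono (B.othersSigma_le u) le_rfl).aestronglyMeasurable
    (hY.mono (B.measurable_ξ u).comap_le le_rfl).aestronglyMeasurable
  rw [integral_excess hA hlam, mul_zero] at h
  rw [← h]
  refine integral_congr_ae (Eventually.of_forall fun ω => ?_)
  by_cases hω : ω ∈ G <;> simp [hω]

/-- The means of the increments are absolutely summable: by independence, each one is at most a
constant times the probability that the individual is born by time `t`. -/
theorem tsum_lintegral_enorm_incr_lt_top [IsProbabilityMeasure P] (hA : B.InstantSubcritical)
    (hlam : lam ∈ interior B.laplaceDom) (t : ℝ≥0) (a : Fin (B.kOrd lam)) (q : Fin p) :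
    ∑' u, ∫⁻ ω, ‖B.incr lam t u a q ω‖ₑ ∂P < ⊤ := by
  choose C hC using fun i b => exists_enorm_weight_le (B := B) (lam := lam) t a b i
  choose D hD hD' using fun i b => exists_lintegral_enorm_excess_le hlam b i q
  have hm : ∀ (u : List ℕ) (i : Fin p) (b : Fin (B.kOrd lam)), Measurable fun ω =>
      ‖B.weight lam t u a b i ω‖ₑ * ‖B.excess lam u b i q ω‖ₑ := fun u i b =>
    ((measurable_weight t a b i).mono (B.othersSigma_le u) le_rfl).enorm.mul
      ((measurable_excess b i q).mono (B.measurable_ξ u).comap_le le_rfl).enorm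
  have hw : ∀ (u : List ℕ) (i : Fin p) (b : Fin (B.kOrd lam)), Measurable[B.othersSigma u] fun ω =>
      ‖B.weight lam t u a b i ω‖ₑ := fun u i b => measurable_enorm.comp (measurable_weight t a b i)
  have he : ∀ (u : List ℕ) (i : Fin p) (b : Fin (B.kOrd lam)),
      Measurable[MeasurableSpace.comap (B.ξ u) inferInstance] fun ω =>
        ‖B.excess lam u b i q ω‖ₑ := fun u i b => measurable_enorm.comp (measurable_excess b i q)
  have hbound : ∀ u, ∫⁻ ω, ‖B.incr lam t u a q ω‖ₑ ∂P ≤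
      ∑ i, ∑ b, C i b * P {ω | B.S u ω ≤ t} * D i b := fun u => by
    calc ∫⁻ ω, ‖B.incr lam t u a q ω‖ₑ ∂P
        ≤ ∫⁻ ω, ∑ i, ∑ b, ‖B.weight lam t u a b i ω‖ₑ * ‖B.excess lam u b i q ω‖ₑ ∂P := by
          refine lintegral_mono fun ω => ?_
          simp only [incr_eq_sum, ← enorm_mul]
          exact (enorm_sum_le _ _).trans (Finset.sum_le_sum fun i _ => enorm_sum_le _ _)
      _ = ∑ i, ∑ b, ∫⁻ ω, ‖B.weight lam t u a b i ω‖ₑ * ‖B.excess lam u b i q ω‖ₑ ∂P := by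
          rw [lintegral_finsetSum _ fun i _ => Finset.measurable_sum _ fun b _ => hm u i b]
          refine Finset.sum_congr rfl fun i _ => ?_
          rw [lintegral_finsetSum _ fun b _ => hm u i b]
      _ ≤ _ := by
          refine Finset.sum_le_sum fun i _ => Finset.sum_le_sum fun b _ => ?_
          rw [lintegral_mul_eq_lintegral_mul_lintegral_of_independent_measurableSpace
            (B.othersSigma_le u) (B.measurable_ξ u).comap_le (B.indep_othersSigma u)
            (hw u i b) (he u i b)]
          refine mul_le_mul' ((lintegral_mono fun ω => hC i b u ω).trans (le_of_eq ?_)) (hD' i b u)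
          have hSm : MeasurableSet {ω | B.S u ω ≤ t} :=
            measurableSet_le (B.measurable_S u) measurable_const
          rw [lintegral_const_mul _ (measurable_const.indicator hSm)]
          congr 1
          exact lintegral_indicator_one hSm
  refine lt_of_le_of_lt (ENNReal.tsum_le_tsum hbound) ?_
  rw [Summable.tsum_finsetSum fun _ _ => ENNReal.summable]
  refine ENNReal.sum_lt_top.2 fun i _ => ?_
  rw [Summable.tsum_finsetSum fun _ _ => ENNReal.summable]
  refine ENNReal.sum_lt_top.2 fun b _ => ?_
  rw [ENNReal.tsum_mul_right, ENNReal.tsum_mul_left]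
  exact ENNReal.mul_lt_top (ENNReal.mul_lt_top ENNReal.coe_lt_top
    (B.tsum_measure_S_le_lt_top hA (interior_subset hlam) t)) (hD i b)

/-! ### The martingale property -/

theorem W_eq_psi_add_tsum_incr {ω : Ω} (h : B.IsRegular lam ω) (t : ℝ≥0) (a : Fin (B.kOrd lam))
    (q : Fin p) : B.W lam t ω a q = B.psi lam [] ω a q + ∑' u, B.incr lam t u a q ω := by
  rw [W_eq_psi_add_sum_increment h t, Matrix.add_apply, Matrix.sum_apply,
    tsum_eq_sum (s := (h.finite t).toFinset)]
  · congr 1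
    refine Finset.sum_congr rfl fun u hu => ?_
    rw [incr, if_pos (by simpa using hu)]
  · intro u hu
    rw [incr, if_neg (by simpa using hu)]

theorem psi_nil_apply (ω : Ω) (a : Fin (B.kOrd lam)) (q : Fin p) :
    B.psi lam [] ω a q = B.vecA lam (a, B.rootType ω) q := by
  have hS : (B.S [] ω).toReal = 0 := rfl
  rw [psi, hS, neg_zero, expMat_zero, kronRow_one_mul_apply]
  rfl

theorem integrable_psi_nil [IsProbabilityMeasure P] (a : Fin (B.kOrd lam)) (q : Fin p) :
    Integrable (fun ω => B.psi lam [] ω a q) P := by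
  simp only [psi_nil_apply]
  have hm : Measurable fun ω => B.vecA lam (a, B.rootType ω) q :=
    (measurable_of_countable fun i => B.vecA lam (a, i) q).comp B.measurable_rootType
  refine Integrable.of_bound hm.aestronglyMeasurable (∑ i, ‖B.vecA lam (a, i) q‖)
    (Eventually.of_forall fun ω => ?_)
  exact Finset.single_le_sum (f := fun i => ‖B.vecA lam (a, i) q‖) (fun i _ => norm_nonneg _)
    (Finset.mem_univ (B.rootType ω))

theorem integrable_W [IsProbabilityMeasure P] (hA : B.InstantSubcritical)
    (hlam : lam ∈ interior B.laplaceDom) (t : ℝ≥0) (a : Fin (B.kOrd lam)) (q : Fin p) :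
    Integrable (fun ω => B.W lam t ω a q) P := by
  refine ⟨((B.stronglyMeasurable_W lam t a q).mono (B.sigmaF_le t)).aestronglyMeasurable, ?_⟩
  have h1 : ∫⁻ ω, ‖B.W lam t ω a q‖ₑ ∂P ≤
      ∫⁻ ω, (‖B.psi lam [] ω a q‖ₑ + ∑' u, ‖B.incr lam t u a q ω‖ₑ) ∂P := by
    refine lintegral_mono_ae ?_
    filter_upwards [ae_isRegular hA hlam] with ω hω
    rw [W_eq_psi_add_tsum_incr hω]
    exact (enorm_add_le _ _).trans (add_le_add le_rfl enorm_tsum_le_tsum_enorm)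
  refine lt_of_le_of_lt h1 ?_
  rw [lintegral_add_left' (integrable_psi_nil a q).aestronglyMeasurable.enorm,
    lintegral_tsum fun u => (integrable_incr hlam t u a q).aestronglyMeasurable.enorm]
  exact ENNReal.add_lt_top.2 ⟨(integrable_psi_nil a q).hasFiniteIntegral,
    tsum_lintegral_enorm_incr_lt_top hA hlam t a q⟩

theorem setIntegral_W [IsProbabilityMeasure P] (hA : B.InstantSubcritical)
    (hlam : lam ∈ interior B.laplaceDom) (t : ℝ≥0) (a : Fin (B.kOrd lam)) (q : Fin p) (G : Set Ω) :
    ∫ ω in G, B.W lam t ω a q ∂P =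
      ∫ ω in G, B.psi lam [] ω a q ∂P + ∑' u, ∫ ω in G, B.incr lam t u a q ω ∂P := by
  have hsum : ∑' u, ∫⁻ ω in G, ‖B.incr lam t u a q ω‖ₑ ∂P ≠ ⊤ :=
    ne_top_of_le_ne_top (tsum_lintegral_enorm_incr_lt_top hA hlam t a q).ne
      (ENNReal.tsum_le_tsum fun u => lintegral_mono' Measure.restrict_le_self le_rfl)
  rw [← integral_tsum (fun u => (integrable_incr hlam t u a q).aestronglyMeasurable.restrict) hsum]
  have hae : ∀ᵐ ω ∂(P.restrict G), B.W lam t ω a q =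
      B.psi lam [] ω a q + ∑' u, B.incr lam t u a q ω := by
    filter_upwards [ae_restrict_of_ae (ae_isRegular hA hlam)] with ω hω
    exact W_eq_psi_add_tsum_incr hω t a q
  have hint : Integrable (fun ω => ∑' u, B.incr lam t u a q ω) (P.restrict G) := by
    refine (((integrable_W hA hlam t a q).sub (integrable_psi_nil a q)).integrableOn).congr ?_
    filter_upwards [hae] with ω hω
    simp only [Pi.sub_apply]
    rw [hω, add_sub_cancel_left]
  rw [integral_congr_ae hae, integral_add (integrable_psi_nil a q).integrableOn hint]

theorem martingale_W [IsProbabilityMeasure P] (hA : B.InstantSubcritical)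
    (hlam : lam ∈ interior B.laplaceDom) (a : Fin (B.kOrd lam)) (q : Fin p) :
    Martingale (fun t ω => B.W lam t ω a q) B.filtration P := by
  refine ⟨fun t => B.stronglyMeasurable_W lam t a q, fun s t hst => ?_⟩
  symm
  refine ae_eq_condExp_of_forall_setIntegral_eq (B.filtration.le s) (integrable_W hA hlam t a q)
    (fun E _ _ => (integrable_W hA hlam s a q).integrableOn) (fun E hE _ => ?_)
    (B.stronglyMeasurable_W lam s a q).aestronglyMeasurable
  rw [setIntegral_W hA hlam, setIntegral_W hA hlam]
  congr 1
  refine tsum_congr fun u => ?_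
  have hSm : MeasurableSet {ω | (s : ℝ≥0∞) < B.S u ω} :=
    measurableSet_lt measurable_const (B.measurable_S u)
  -- only the individuals born in `(s, t]` make a difference, and those do not influence `F_s`
  have hsplit : ∀ ω, B.incr lam t u a q ω = B.incr lam s u a q ω +
      {ω | (s : ℝ≥0∞) < B.S u ω}.indicator (B.incr lam t u a q) ω := fun ω => by
    by_cases h : B.S u ω ≤ s
    · rw [Set.indicator_of_notMem (show ω ∉ {ω | (s : ℝ≥0∞) < B.S u ω} from not_lt.2 h), add_zero, incr, incr, if_pos h,
        if_pos (h.trans (ENNReal.coe_le_coe.2 hst))]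
    · rw [Set.indicator_of_mem (show ω ∈ {ω | (s : ℝ≥0∞) < B.S u ω} from not_le.1 h)]
      simp only [incr, if_neg h, zero_add]
  have hzero := setIntegral_incr_eq_zero hA hlam t a q (B.measurableSet_othersSigma_inter hE (u := u))
  simp only [hsplit]
  rw [integral_add (integrable_incr hlam s u a q).integrableOn
    ((integrable_incr hlam t u a q).indicator hSm).integrableOn, setIntegral_indicator hSm, hzero,
    add_zero]

theorem integral_W_lawGiven [IsProbabilityMeasure P] (hA : B.InstantSubcritical)
    (hlam : lam ∈ interior B.laplaceDom) {i : Fin p} (hi : P (B.rootType ⁻¹' {i}) ≠ 0)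
    (t : ℝ≥0) (a : Fin (B.kOrd lam)) (q : Fin p) :
    ∫ ω, B.W lam t ω a q ∂(B.lawGiven i) = B.vecA lam (a, i) q := by
  have hG : MeasurableSet (B.rootType ⁻¹' {i}) := B.measurable_rootType (measurableSet_singleton i)
  rw [lawGiven, ProbabilityTheory.cond, integral_smul_measure, setIntegral_W hA hlam]
  have h0 : ∀ u, ∫ ω in B.rootType ⁻¹' {i}, B.incr lam t u a q ω ∂P = 0 := fun u =>
    setIntegral_incr_eq_zero hA hlam t a q
      (B.measurable_rootType_othersSigma u (measurableSet_singleton i))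
  have h1 : ∫ ω in B.rootType ⁻¹' {i}, B.psi lam [] ω a q ∂P =
      ∫ _ω in B.rootType ⁻¹' {i}, B.vecA lam (a, i) q ∂P := by
    refine setIntegral_congr_fun hG fun ω hω => ?_
    simp only [psi_nil_apply]
    rw [show B.rootType ω = i from hω]
  simp only [h0, tsum_zero, add_zero]
  rw [h1, setIntegral_const, smul_smul, Measure.real, ← ENNReal.toReal_mul,
    ENNReal.inv_mul_cancel hi (measure_ne_top _ _), ENNReal.toReal_one, one_smul]

end Branching

end CMJ

theorem theorem2p1 {Ω : Type*} [mΩ : MeasurableSpace Ω] (P : MeasureTheory.Measure Ω)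
    [MeasureTheory.IsProbabilityMeasure P] {p : ℕ} (B : CMJ.Branching p P)
    (hA1 : B.InstantSubcritical) (hA2 : B.HasMalthusian) (lam : ℂ) (hlam : lam ∈ interior B.laplaceDom)
    (hdet : (1 - B.laplace lam).det = 0) :
    -- almost surely, for all `t`, the series that defines `Z_t` converges, all but finitely many
    -- of its terms being zero
    (∀ᵐ ω ∂P, ∀ t : ℝ≥0, {u : List ℕ | B.contribution lam t u ω ≠ 0}.Finite) ∧
    -- `(F_t)` is a filtration and (every entry of) `W` is a martingale with respect to it
    (∃ F : MeasureTheory.Filtration ℝ≥0 mΩ,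
      (∀ t, F t = B.sigmaF t) ∧
      ∀ (a : Fin (B.kOrd lam)) (j : Fin p),
        MeasureTheory.Martingale (fun t ω => B.W lam t ω a j) F P) ∧
    -- for every type `i` of the ancestor, `E^i[W_t] = E^i[W_0] = (I ⊗ e_i) A`
    (∀ i : Fin p, P (B.rootType ⁻¹' {i}) ≠ 0 →
      ∀ (t : ℝ≥0) (a : Fin (B.kOrd lam)) (j : Fin p),
        ∫ ω, B.W lam t ω a j ∂(B.lawGiven i) = ∫ ω, B.W lam 0 ω a j ∂(B.lawGiven i) ∧
        ∫ ω, B.W lam 0 ω a j ∂(B.lawGiven i) =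
          (CMJ.kronRow (1 : Matrix (Fin (B.kOrd lam)) (Fin (B.kOrd lam)) ℂ) i * B.vecA lam) a j) ∧
    -- the representation as a sum over the coming generation
    (∀ᵐ ω ∂P, ∀ t : ℝ≥0,
      HasSum
        (fun u : B.coming t ω =>
          CMJ.kronRow (CMJ.expMat (B.kOrd lam) lam (-(B.S u ω).toReal)) (B.type u ω) * B.vecA lam)
        (B.W lam t ω)) := by
  have hreg := CMJ.Branching.ae_isRegular hA1 hlam
  refine ⟨?_, ⟨B.filtration, fun _ => rfl, fun a j => CMJ.Branching.martingale_W hA1 hlam a j⟩,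
    fun i hi t a j => ⟨?_, ?_⟩, ?_⟩
  · filter_upwards [hreg] with ω hω t
    exact CMJ.Branching.finite_contribution_ne_zero hω t
  · rw [CMJ.Branching.integral_W_lawGiven hA1 hlam hi, CMJ.Branching.integral_W_lawGiven hA1 hlam hi]
  · rw [CMJ.Branching.integral_W_lawGiven hA1 hlam hi, CMJ.kronRow_one_mul_apply]
  · filter_upwards [hreg] with ω hω t
    exact CMJ.Branching.hasSum_coming hω t
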